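/- Let $d\in\mathbb N\cup\{\infty\}$, let $\mathbb F^d$ be the free monoid of words in $d$ letters, and for a Hilbert space $\mathcal E$ let $\mathbb H^2_d\otimes\mathcal E$ be the full Fock space of formal power series $f=\sum_{\omega\in\mathbb F^d}\mathfrak z^\omega f_\omega$ in non-commuting variables $\mathfrak z_1,\dots,\mathfrak z_d$, with $f_\omega\in\mathcal E$ and $\|f\|^2=\sum_\omega\|f_\omega\|^2<\infty$. Let $L=(L_1,\dots,L_d):(\mathbb H^2_d\otimes\mathcal E)\otimes\mathbb C^d\to\mathbb H^2_d\otimes\mathcal E$ be the row isometry of left multiplications by the variables (tensored with $I_{\mathcal E}$), and let $U_{\mathrm t}$ be the unitary $\mathfrak z^\omega x\mapsto\mathfrak z^{\omega^{\mathrm t}}x$ reversing the letters of words ($x\in\mathcal E$). Let $\mathcal H,\mathcal J$ be separable complex Hilbert spaces, $\mathcal J\neq\{0\}$. A contractive left multiplier $b\in[\mathbb H^\infty_d\otimes\mathscr L(\mathcal H,\mathcal J)]_1$ is a formal power series $b=\sum_\omega\mathfrak z^\omega\hat b_\omega$, $\hat b_\omega\in\mathscr L(\mathcal H,\mathcal J)$,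 such that left multiplication by $b$ is a contraction $b(L):\mathbb H^2_d\otimes\mathcal H\to\mathbb H^2_d\otimes\mathcal J$; put $b(R):=U_{\mathrm t}\,b(L)\,U_{\mathrm t}$. The multiplier $b$ is inner if $b(L)$ is an isometry, and column-extreme (CE) if $a\in[\mathbb H^\infty_d\otimes\mathscr L(\mathcal H,\mathcal J)]_1$ and contractivity of the column $\left(\begin{smallmatrix}b\\a\end{smallmatrix}\right)$ as a left multiplier from $\mathbb H^2_d\otimes\mathcal H$ to $\mathbb H^2_d\otimes\mathcal J\otimes\mathbb C^2$ imply $a\equiv0$. Let $\mathscr H^{\mathrm t}(b)$ be the right free de Branges--Rovnyak space of $b$, that is, the range of $\sqrt{I-b(R)b(R)^*}$ with the Hilbert space norm that makes this operator a co-isometry onto its range. It is invariant under the backward left shifts $L_k^*$; let $X:=L^*|_{\mathscr H^{\mathrm t}(b)}:\mathscr H^{\mathrm t}(b)\to\mathscr H^{\mathrm t}(b)\otimes\mathbb C^d$, and let $\boldsymbol b:\mathcal H\to\mathscr H^{\mathrm t}(b)\otimes\mathbb C^d$ be the bounded operator $\boldsymbol b\,h:=L^*\,b(R)(1\otimes h)$.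 Let $X^{(n)}:=(X\otimes I_d\otimes\cdots\otimes I_d)\cdots(X\otimes I_d)X$ ($n$ factors), acting on $\mathscr H^{\mathrm t}(b)\otimes\mathbb C^d$ as $X^{(n)}\otimes I_d$, so that $\|X^{(n)}(x_k)_k\|^2=\sum_k\sum_{|\alpha|=n}\|X^\alpha x_k\|^2$, with norms in $\mathscr H^{\mathrm t}(b)$. A row $T=(T_1,\dots,T_d):\mathcal K\otimes\mathbb C^d\to\mathcal K$ is pure if $\mathrm{Ad}_{T,T^*}^{(n)}(I)\to0$ in the strong operator topology, where $\mathrm{Ad}_{T,T^*}(A)=\sum_kT_kAT_k^*$. **Theorem.** Let $b\in[\mathbb H^\infty_d\otimes\mathscr L(\mathcal H,\mathcal J)]_1$ be column-extreme. Then $b$ is inner if and only if $X^*$ obeys the weak purity condition $\|X^{(n)}\boldsymbol b\,h\|\to0$ as $n\to\infty$ for every $h\in\mathcal H$. In particular, $X^*$ is pure if and only if $b$ is inner. -/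

import Mathlib

set_option linter.unusedSectionVars false

noncomputable section

namespace FreeHardy

open ContinuousLinearMap

universe u v

/-! ### Hilbert-space direct sums `K ⊗ ℓ²(S)` -/

/-- The Hilbert space `K ⊗ ℓ²(S)` of square-summable families in `K` indexed by `S`.
In particular `K ⊗ ℂ^d` is `l2 ι K`, where `ι` has `d` elements. -/
abbrev l2 (S : Type u) (K : Type v) [NormedAddCommGroup K] : Type (max u v) :=
  lp (fun _ : S => K) 2

section l2

variable {S : Type*} {T : Type*} {K : Type*} [NormedAddCommGroup K]

theorem memlp_two_iff (f : S → K) : Memℓp f 2 ↔ Summable fun s => ‖f s‖ ^ 2 := by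
  rw [memℓp_gen_iff (by norm_num)]
  norm_num

theorem l2_hasSum (f : l2 S K) : HasSum (fun s => ‖f s‖ ^ 2) (‖f‖ ^ 2) := by
  have h := lp.hasSum_norm (p := 2) (by norm_num) f
  norm_num at h
  exact h

theorem l2_norm_sq (f : l2 S K) : ‖f‖ ^ 2 = ∑' s, ‖f s‖ ^ 2 := (l2_hasSum f).tsum_eq.symm

theorem extend_norm_sq {φ : S → T} (hφ : Function.Injective φ) (f : S → K) :
    (fun t => ‖Function.extend φ f 0 t‖ ^ 2) =
      Function.extend φ (fun s => ‖f s‖ ^ 2) 0 := by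
  classical
  funext t
  by_cases ht : ∃ s, φ s = t
  · obtain ⟨s, rfl⟩ := ht
    simp [hφ.extend_apply]
  · simp [Function.extend_apply' _ _ _ ht]

theorem extend_hasSum {φ : S → T} (hφ : Function.Injective φ) (f : l2 S K) :
    HasSum (fun t => ‖Function.extend φ (f : S → K) 0 t‖ ^ 2) (‖f‖ ^ 2) := by
  rw [extend_norm_sq hφ]
  exact (hasSum_extend_zero hφ).2 (l2_hasSum f)

variable [InnerProductSpace ℂ K]

/-- The isometry `K ⊗ ℓ²(S) → K ⊗ ℓ²(T)` which sends the basis vector `e_s` to `e_{φ s}`,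
for an injective map `φ`. -/
def push (φ : S → T) (hφ : Function.Injective φ) : l2 S K →ₗᵢ[ℂ] l2 T K where
  toFun f := ⟨Function.extend φ f 0, (memlp_two_iff _).2 (extend_hasSum hφ f).summable⟩
  map_add' f g := by
    ext t
    change Function.extend φ (⇑f + ⇑g) 0 t =
      Function.extend φ (⇑f) 0 t + Function.extend φ (⇑g) 0 t
    by_cases ht : ∃ s, φ s = t
    · obtain ⟨s, rfl⟩ := ht
      simp [Pi.add_apply, hφ.extend_apply]
    · simp [Function.extend_apply' _ _ _ ht]
  map_smul' c f := by
    ext t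
    by_cases ht : ∃ s, φ s = t
    · obtain ⟨s, rfl⟩ := ht
      simp [hφ.extend_apply]
    · simp [Function.extend_apply' _ _ _ ht]
  norm_map' f := by
    rw [← sq_eq_sq₀ (norm_nonneg _) (norm_nonneg _), l2_norm_sq]
    exact (extend_hasSum hφ f).tsum_eq

theorem push_apply (φ : S → T) (hφ : Function.Injective φ) (f : l2 S K) (s : S) :
    push φ hφ f (φ s) = f s :=
  hφ.extend_apply _ _ _

theorem push_apply_of_not (φ : S → T) (hφ : Function.Injective φ) (f : l2 S K) (t : T)
    (ht : ¬ ∃ s, φ s = t) : push φ hφ f t = 0 :=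
  Function.extend_apply' _ _ _ ht

theorem uncurry_hasSum (f : l2 S (l2 T K)) :
    HasSum (fun p : S × T => ‖f p.1 p.2‖ ^ 2) (‖f‖ ^ 2) := by
  have h1 : Summable fun p : S × T => ‖f p.1 p.2‖ ^ 2 := by
    rw [summable_prod_of_nonneg (fun _ => by positivity)]
    refine ⟨fun s => (l2_hasSum (f s)).summable, ?_⟩
    have := (l2_hasSum f).summable
    simpa only [l2_norm_sq] using this
  have h2 := h1.hasSum.prod_fiberwise fun s => l2_hasSum (f s)
  rw [(l2_hasSum f).unique h2]
  exact h1.hasSum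

/-- The canonical identification `(K ⊗ ℓ²(T)) ⊗ ℓ²(S) = K ⊗ ℓ²(S × T)`. -/
def uncurry : l2 S (l2 T K) →ₗᵢ[ℂ] l2 (S × T) K where
  toFun f := ⟨fun p => f p.1 p.2, (memlp_two_iff _).2 (uncurry_hasSum f).summable⟩
  map_add' f g := by ext p; rfl
  map_smul' c f := by ext p; rfl
  norm_map' f := by
    rw [← sq_eq_sq₀ (norm_nonneg _) (norm_nonneg _), l2_norm_sq]
    exact (uncurry_hasSum f).tsum_eq

/-- The ampliation `A ⊗ I : K ⊗ ℓ²(S) → K' ⊗ ℓ²(S)` of `A : K → K'`. -/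
def ampl (S : Type*) {K' : Type*} [NormedAddCommGroup K'] [InnerProductSpace ℂ K']
    (A : K →L[ℂ] K') : l2 S K →L[ℂ] l2 S K' :=
  lp.mapCLM 2 (fun _ => A) (norm_nonneg A) (fun _ => le_rfl)

theorem ampl_apply {K' : Type*} [NormedAddCommGroup K'] [InnerProductSpace ℂ K']
    (A : K →L[ℂ] K') (f : l2 S K) (s : S) : ampl S A f s = A (f s) := rfl

end l2

/-! ### Operator-range spaces -/

section OperatorRange

variable {K₁ K₂ : Type*} [NormedAddCommGroup K₁] [InnerProductSpace ℂ K₁] [CompleteSpace K₁]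
  [NormedAddCommGroup K₂] [InnerProductSpace ℂ K₂]

/-- The operator-range space `𝓜(A)`: as a vector space it is the range of `A`. Its norm (below) is
the one which makes `A` a co-isometry onto `𝓜(A)`. -/
def OperatorRange (A : K₁ →L[ℂ] K₂) : Type _ := LinearMap.range (A : K₁ →ₗ[ℂ] K₂)

namespace OperatorRange

variable (A : K₁ →L[ℂ] K₂)

instance : AddCommGroup (OperatorRange A) :=
  inferInstanceAs (AddCommGroup (LinearMap.range (A : K₁ →ₗ[ℂ] K₂)))

instance : Module ℂ (OperatorRange A) :=
  inferInstanceAs (Module ℂ (LinearMap.range (A : K₁ →ₗ[ℂ] K₂)))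

/-- The inclusion of `𝓜(A)` into the ambient space. -/
def incl : OperatorRange A →ₗ[ℂ] K₂ := (LinearMap.range (A : K₁ →ₗ[ℂ] K₂)).subtype

theorem incl_injective : Function.Injective (incl A) := Subtype.val_injective

/-- `A` is a bijection from `(ker A)ᗮ` onto its range. -/
def equiv : (LinearMap.ker (A : K₁ →ₗ[ℂ] K₂))ᗮ ≃ₗ[ℂ] OperatorRange A :=
  haveI : CompleteSpace (LinearMap.ker (A : K₁ →ₗ[ℂ] K₂)) :=
    (ContinuousLinearMap.isClosed_ker A).completeSpace_coe
  (A : K₁ →ₗ[ℂ] K₂).kerComplementEquivRange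
    (Submodule.isCompl_orthogonal _).symm

theorem incl_equiv (x : (LinearMap.ker (A : K₁ →ₗ[ℂ] K₂))ᗮ) : incl A (equiv A x) = A x := rfl

/-- The preimage under `A` of an element of `𝓜(A)` that is orthogonal to `ker A`. -/
def preimage : OperatorRange A →ₗ[ℂ] K₁ :=
  (LinearMap.ker (A : K₁ →ₗ[ℂ] K₂))ᗮ.subtype ∘ₗ (equiv A).symm.toLinearMap

theorem preimage_injective : Function.Injective (preimage A) :=
  Subtype.val_injective.comp (equiv A).symm.injective

theorem apply_preimage (f : OperatorRange A) : A (preimage A f) = incl A f := by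
  obtain ⟨x, rfl⟩ := (equiv A).surjective f
  simp [preimage, incl_equiv]

/-- The norm of `f ∈ 𝓜(A)` is the norm of its preimage in `(ker A)ᗮ`. -/
instance : NormedAddCommGroup (OperatorRange A) :=
  NormedAddCommGroup.induced _ _ (preimage A) (preimage_injective A)

instance : InnerProductSpace ℂ (OperatorRange A) := InnerProductSpace.induced (preimage A)

theorem norm_def (f : OperatorRange A) : ‖f‖ = ‖preimage A f‖ := rfl

/-- `preimage A` as a bounded operator. -/
def preimageCLM : OperatorRange A →L[ℂ] K₁ :=
  (preimage A).mkContinuous 1 fun f => by rw [one_mul, norm_def]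

/-- `A` restricts to a unitary from `(ker A)ᗮ` onto `𝓜(A)`. -/
def unitary : (LinearMap.ker (A : K₁ →ₗ[ℂ] K₂))ᗮ ≃ₗᵢ[ℂ] OperatorRange A where
  toLinearEquiv := equiv A
  norm_map' x := by simp [norm_def, preimage]

instance : CompleteSpace (OperatorRange A) :=
  (unitary A).toIsometryEquiv.completeSpace_iff.1 inferInstance

/-- `A`, viewed as an operator onto `𝓜(A)`. -/
def corestrict : K₁ →L[ℂ] OperatorRange A :=
  haveI : CompleteSpace (LinearMap.ker (A : K₁ →ₗ[ℂ] K₂)) :=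
    (ContinuousLinearMap.isClosed_ker A).completeSpace_coe
  (unitary A).toContinuousLinearEquiv.toContinuousLinearMap ∘L
    (LinearMap.ker (A : K₁ →ₗ[ℂ] K₂))ᗮ.orthogonalProjectionOnto

theorem incl_corestrict (x : K₁) : incl A (corestrict A x) = A x := by
  have : CompleteSpace (LinearMap.ker (A : K₁ →ₗ[ℂ] K₂)) :=
    (ContinuousLinearMap.isClosed_ker A).completeSpace_coe
  change A ((LinearMap.ker (A : K₁ →ₗ[ℂ] K₂))ᗮ.orthogonalProjectionOnto x : K₁) = A x
  have h := Submodule.sub_starProjection_mem_orthogonal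
    (K := (LinearMap.ker (A : K₁ →ₗ[ℂ] K₂))ᗮ) x
  rw [Submodule.orthogonal_orthogonal] at h
  have h' : A (x - (LinearMap.ker (A : K₁ →ₗ[ℂ] K₂))ᗮ.starProjection x) = 0 := h
  rw [map_sub, sub_eq_zero] at h'
  exact h'.symm

end OperatorRange

/-- `√(I - B B*)` for a contraction `B`. -/
def sqrtDefect [CompleteSpace K₂] (B : K₁ →L[ℂ] K₂) : K₂ →L[ℂ] K₂ :=
  CFC.sqrt (1 - B ∘L adjoint B)

theorem adjoint_sqrtDefect [CompleteSpace K₂] (B : K₁ →L[ℂ] K₂) :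
    adjoint (sqrtDefect B) = sqrtDefect B :=
  (IsSelfAdjoint.of_nonneg (CFC.sqrt_nonneg (1 - B ∘L adjoint B))).adjoint_eq

theorem norm_sqrtDefect_sq [CompleteSpace K₂] (B : K₁ →L[ℂ] K₂)
    (hB : ∀ f, ‖adjoint B f‖ ≤ ‖f‖) (f : K₂) :
    ‖sqrtDefect B f‖ ^ 2 = ‖f‖ ^ 2 - ‖adjoint B f‖ ^ 2 := by
  have hform : ∀ f : K₂, (inner ℂ ((1 - B ∘L adjoint B) f) f).re =
      ‖f‖ ^ 2 - ‖adjoint B f‖ ^ 2 := by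
    intro f
    have h1 := inner_self_eq_norm_sq (𝕜 := ℂ) f
    have h2 := inner_self_eq_norm_sq (𝕜 := ℂ) (adjoint B f)
    rw [adjoint_inner_right] at h2
    rw [sub_apply, inner_sub_left, Complex.sub_re]
    exact congrArg₂ _ h1 h2
  have hpos : 0 ≤ 1 - B ∘L adjoint B := by
    rw [nonneg_iff_isPositive]
    refine ⟨?_, fun f => ?_⟩
    · apply IsSelfAdjoint.isSymmetric
      rw [isSelfAdjoint_iff', map_sub, adjoint_comp, adjoint_adjoint]
      congr 1
      exact adjoint_id
    · have h3 : 0 ≤ ‖f‖ ^ 2 - ‖adjoint B f‖ ^ 2 := by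
        have := pow_le_pow_left₀ (norm_nonneg _) (hB f) 2
        linarith
      rw [← hform f] at h3
      exact h3
  have hsq : sqrtDefect B ∘L sqrtDefect B = 1 - B ∘L adjoint B := CFC.sqrt_mul_sqrt_self _ hpos
  rw [← hform f, ← hsq, ← inner_self_eq_norm_sq (𝕜 := ℂ), ← adjoint_inner_left,
    adjoint_sqrtDefect]
  rfl

/-- Douglas' factorization lemma. -/
theorem exists_factor {K₃ : Type*} [NormedAddCommGroup K₃] [InnerProductSpace ℂ K₃]
    [CompleteSpace K₃] [CompleteSpace K₂] (A : K₁ →L[ℂ] K₂) (D : K₃ →L[ℂ] K₂)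
    (h : ∀ y, ‖adjoint A y‖ ≤ ‖adjoint D y‖) : ∃ C : K₁ →L[ℂ] K₃, D ∘L C = A := by
  let M : Submodule ℂ K₃ := (LinearMap.range (adjoint D : K₂ →ₗ[ℂ] K₃)).topologicalClosure
  have : CompleteSpace M := (Submodule.isClosed_topologicalClosure _).completeSpace_coe
  let e : K₂ →ₗ[ℂ] M := LinearMap.codRestrict M (adjoint D : K₂ →ₗ[ℂ] K₃)
    fun y => Submodule.le_topologicalClosure _ ⟨y, rfl⟩
  have he : DenseRange e := by
    intro x
    rw [Topology.IsEmbedding.subtypeVal.closure_eq_preimage_closure_image, Set.mem_preimage]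
    have : (Subtype.val '' Set.range e : Set K₃) = LinearMap.range (adjoint D : K₂ →ₗ[ℂ] K₃) := by
      rw [← Set.range_comp]
      rfl
    rw [this]
    exact x.2
  let g : M →L[ℂ] K₁ := (adjoint A : K₂ →ₗ[ℂ] K₁).extendOfNorm e
  have hg : ∀ y, g (e y) = adjoint A y := fun y =>
    LinearMap.extendOfNorm_eq he ⟨1, fun y => by simpa [e] using h y⟩ y
  refine ⟨adjoint (g ∘L M.orthogonalProjectionOnto), ?_⟩
  apply (adjoint (𝕜 := ℂ)).injective
  rw [adjoint_comp, adjoint_adjoint]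
  ext y
  have : M.orthogonalProjectionOnto (adjoint D y) = e y :=
    Submodule.orthogonalProjectionOnto_mem_subspace_eq_self (e y)
  simp [this, hg]

end OperatorRange

/-! ### The full Fock space and operator-valued multipliers -/

/-- The free monoid on the alphabet `ι`; the word `i₁ ⋯ iₙ` is the list `[i₁, …, iₙ]`. -/
abbrev Word (ι : Type u) : Type u := List ι

/-- The vector-valued full Fock space `ℍ²_d ⊗ E`, `d = |ι|`: square-summable power series
`∑ 𝔷^ω f_ω` in the non-commuting variables `𝔷_i`, with coefficients `f_ω ∈ E`. -/
abbrev Fock (ι : Type u) (E : Type v) [NormedAddCommGroup E] : Type (max u v) := l2 (Word ι) E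

section Fock

variable (ι : Type*) (E : Type*) [NormedAddCommGroup E] [InnerProductSpace ℂ E]

theorem cons_injective : Function.Injective fun p : ι × Word ι => p.1 :: p.2 := by
  rintro ⟨i, α⟩ ⟨j, β⟩ h
  simpa using h

/-- The left free shift `L ⊗ I_E = (L₁ ⊗ I_E, …, L_d ⊗ I_E) : (ℍ²_d ⊗ E) ⊗ ℂ^d → ℍ²_d ⊗ E`,
a row isometry: `L_i` is left multiplication by `𝔷_i`, that is `L_i 𝔷^ω = 𝔷^{iω}`. -/
def leftShift : l2 ι (Fock ι E) →ₗᵢ[ℂ] Fock ι E :=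
  (push (fun p : ι × Word ι => p.1 :: p.2) (cons_injective ι)).comp uncurry

/-- The letter-reversal unitary `U_t ⊗ I_E`, `𝔷^ω ↦ 𝔷^{ωᵗ}`. -/
def reversal : Fock ι E →ₗᵢ[ℂ] Fock ι E := push List.reverse List.reverse_injective

/-- The embedding `h ↦ 1 ⊗ h` of `E` as the constants. -/
def vacuum : E →L[ℂ] Fock ι E :=
  haveI := Classical.decEq (Word ι)
  lp.singleContinuousLinearMap ℂ (fun _ : Word ι => E) 2 []

end Fock

section Multiplier

variable {ι : Type*} {H : Type*} {J : Type*}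
  [NormedAddCommGroup H] [InnerProductSpace ℂ H]
  [NormedAddCommGroup J] [InnerProductSpace ℂ J]

/-- The coefficients `∑_{αβ = ω} b_α f_β` of the product of the formal power series
`b = ∑ 𝔷^ω b_ω`, `b_ω ∈ 𝓛(H, J)`, and `f = ∑ 𝔷^ω f_ω`, `f_ω ∈ H`. -/
def seriesMul (b : Word ι → H →L[ℂ] J) (f : Word ι → H) (ω : Word ι) : J :=
  ∑ k ∈ Finset.range (ω.length + 1), b (ω.take k) (f (ω.drop k))

/-- Left multiplication by the formal power series `b` maps `ℍ²_d ⊗ H` contractively into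
`ℍ²_d ⊗ J`. -/
def IsContractiveMultiplier (b : Word ι → H →L[ℂ] J) : Prop :=
  ∀ f : Fock ι H, ∃ g : Fock ι J, (∀ ω, g ω = seriesMul b f ω) ∧ ‖g‖ ≤ ‖f‖

variable (ι H J) in
/-- The closed unit ball `[ℍ^∞_d ⊗ 𝓛(H, J)]₁` of contractive operator-valued left multipliers. -/
structure ContractiveMultiplier where
  /-- the Taylor coefficients -/
  coeff : Word ι → H →L[ℂ] J
  contractive : IsContractiveMultiplier coeff

namespace ContractiveMultiplier

theorem exists_op (b : ContractiveMultiplier ι H J) : ∃ B : Fock ι H →L[ℂ] Fock ι J,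
    (∀ f ω, B f ω = seriesMul b.coeff f ω) ∧ ‖B‖ ≤ 1 := by
  choose g hg hn using b.contractive
  let B₀ : Fock ι H →ₗ[ℂ] Fock ι J :=
    { toFun := g
      map_add' := fun x y => by
        ext ω
        simp [hg, seriesMul, Finset.sum_add_distrib]
      map_smul' := fun c x => by
        ext ω
        simp [hg, seriesMul, Finset.smul_sum] }
  exact ⟨B₀.mkContinuous 1 fun x => by simpa [B₀] using hn x, fun f ω => hg f ω,
    B₀.mkContinuous_norm_le zero_le_one _⟩

/-- The operator `b(L)` of left multiplication by `b`. -/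
def opL (b : ContractiveMultiplier ι H J) : Fock ι H →L[ℂ] Fock ι J := b.exists_op.choose

theorem opL_apply (b : ContractiveMultiplier ι H J) (f : Fock ι H) (ω : Word ι) :
    b.opL f ω = seriesMul b.coeff f ω := b.exists_op.choose_spec.1 f ω

theorem norm_opL_le (b : ContractiveMultiplier ι H J) : ‖b.opL‖ ≤ 1 := b.exists_op.choose_spec.2

/-- `b(R) = (U_t ⊗ I_J) b(L) (U_t ⊗ I_H)`, the operator of right multiplication by `bᵗ`. -/
def opR (b : ContractiveMultiplier ι H J) : Fock ι H →L[ℂ] Fock ι J :=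
  (reversal ι J).toContinuousLinearMap ∘L b.opL ∘L (reversal ι H).toContinuousLinearMap

/-- `b` is inner if the multiplication operator `b(L)` is an isometry. -/
def IsInner (b : ContractiveMultiplier ι H J) : Prop := Isometry b.opL

/-- The coefficients of the column `(b, a)ᵀ`, with values in `𝓛(H, J ⊗ ℂ²)`. -/
def column (b a : ContractiveMultiplier ι H J) (ω : Word ι) : H →L[ℂ] WithLp 2 (J × J) :=
  (WithLp.prodContinuousLinearEquiv 2 ℂ J J).symm.toContinuousLinearMap ∘L
    (b.coeff ω).prod (a.coeff ω)

/-- `b` is column-extreme if the column `(b, a)ᵀ` is contractive only for `a ≡ 0`. -/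
def IsColumnExtreme (b : ContractiveMultiplier ι H J) : Prop :=
  ∀ a : ContractiveMultiplier ι H J, IsContractiveMultiplier (column b a) → ∀ ω, a.coeff ω = 0

end ContractiveMultiplier
end Multiplier

/-! ### The right free de Branges--Rovnyak space -/

section DeBrangesRovnyak

variable {ι : Type*} {H : Type*} {J : Type*}
  [NormedAddCommGroup H] [InnerProductSpace ℂ H] [CompleteSpace H]
  [NormedAddCommGroup J] [InnerProductSpace ℂ J] [CompleteSpace J]

theorem adjoint_ampl {S K K' : Type*} [NormedAddCommGroup K] [InnerProductSpace ℂ K]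
    [CompleteSpace K] [NormedAddCommGroup K'] [InnerProductSpace ℂ K'] [CompleteSpace K']
    (A : K →L[ℂ] K') : adjoint (ampl S A) = ampl S (adjoint A) := by
  symm
  rw [eq_adjoint_iff]
  intro x y
  simp only [lp.inner_eq_tsum, ampl_apply, adjoint_inner_left]

theorem leftShift_cons {E : Type*} [NormedAddCommGroup E] [InnerProductSpace ℂ E]
    (y : l2 ι (Fock ι E)) (j : ι) (ω : Word ι) : leftShift ι E y (j :: ω) = y j ω :=
  push_apply (fun p : ι × Word ι => p.1 :: p.2) (cons_injective ι) (uncurry y) (j, ω)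

theorem leftShift_nil {E : Type*} [NormedAddCommGroup E] [InnerProductSpace ℂ E]
    (y : l2 ι (Fock ι E)) : leftShift ι E y [] = 0 :=
  push_apply_of_not (fun p : ι × Word ι => p.1 :: p.2) (cons_injective ι) (uncurry y) [] (by simp)

theorem reversal_apply {E : Type*} [NormedAddCommGroup E] [InnerProductSpace ℂ E]
    (f : Fock ι E) (ω : Word ι) : reversal ι E f ω = f ω.reverse := by
  conv_lhs => rw [← List.reverse_reverse ω]
  exact push_apply _ _ f ω.reverse

namespace ContractiveMultiplier

theorem norm_opR_apply_le (b : ContractiveMultiplier ι H J) (f : Fock ι H) :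
    ‖b.opR f‖ ≤ ‖f‖ := by
  change ‖reversal ι J (b.opL (reversal ι H f))‖ ≤ ‖f‖
  rw [LinearIsometry.norm_map]
  have := b.opL.le_of_opNorm_le b.norm_opL_le (reversal ι H f)
  rwa [LinearIsometry.norm_map, one_mul] at this

theorem opR_leftShift (b : ContractiveMultiplier ι H J) (y : l2 ι (Fock ι H)) :
    b.opR (leftShift ι H y) = leftShift ι J (ampl ι b.opR y) := by
  have key : ∀ (f : Fock ι H) (ω : Word ι), b.opR f ω =
      ∑ k ∈ Finset.range (ω.length + 1),
        b.coeff (ω.reverse.take k) (f (ω.reverse.drop k).reverse) := by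
    intro f ω
    change reversal ι J (b.opL (reversal ι H f)) ω = _
    simp only [reversal_apply, opL_apply, seriesMul, List.length_reverse]
  ext ω
  cases ω with
  | nil => simp [key, leftShift_nil]
  | cons j ω =>
    rw [leftShift_cons, ampl_apply, key, key, List.length_cons, Finset.sum_range_succ]
    have h0 : ((j :: ω).reverse.drop (ω.length + 1)).reverse = [] := by simp
    rw [h0, leftShift_nil, map_zero, add_zero]
    refine Finset.sum_congr rfl fun k hk => ?_
    have hk' : k ≤ ω.reverse.length := by
      have := Finset.mem_range.1 hk
      simp; omega
    rw [List.reverse_cons, List.take_append_of_le_length hk', List.drop_append_of_le_length hk',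
      List.reverse_append, List.reverse_singleton, List.singleton_append, leftShift_cons]

/-- The defect operator `√(I - b(R) b(R)*)`. -/
def defect (b : ContractiveMultiplier ι H J) : Fock ι J →L[ℂ] Fock ι J := sqrtDefect b.opR

/-- The right free de Branges--Rovnyak space `𝓗ᵗ(b) = 𝓜(√(I - b(R) b(R)*))`. -/
abbrev DBR (b : ContractiveMultiplier ι H J) := OperatorRange b.defect

theorem adjoint_defect (b : ContractiveMultiplier ι H J) : adjoint b.defect = b.defect :=
  adjoint_sqrtDefect b.opR

theorem norm_adjoint_opR_apply_le (b : ContractiveMultiplier ι H J) (f : Fock ι J) :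
    ‖adjoint b.opR f‖ ≤ ‖f‖ := by
  have h : ‖adjoint b.opR‖ ≤ 1 := by
    rw [LinearIsometryEquiv.norm_map]
    exact b.opR.opNorm_le_bound zero_le_one fun f => by simpa using b.norm_opR_apply_le f
  simpa using (adjoint b.opR).le_of_opNorm_le h f

theorem norm_defect_sq (b : ContractiveMultiplier ι H J) (f : Fock ι J) :
    ‖b.defect f‖ ^ 2 = ‖f‖ ^ 2 - ‖adjoint b.opR f‖ ^ 2 :=
  norm_sqrtDefect_sq b.opR b.norm_adjoint_opR_apply_le f

theorem adjoint_leftShift_adjoint_opR (b : ContractiveMultiplier ι H J) (y : l2 ι (Fock ι J)) :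
    adjoint (leftShift ι H).toContinuousLinearMap
      (adjoint b.opR (leftShift ι J y)) = ampl ι (adjoint b.opR) y := by
  apply ext_inner_left ℂ
  intro x
  rw [adjoint_inner_right, adjoint_inner_right, ← adjoint_ampl, adjoint_inner_right,
    ← (leftShift ι J).inner_map_map, ← opR_leftShift]
  rfl

theorem norm_ampl_defect_sq (b : ContractiveMultiplier ι H J) (y : l2 ι (Fock ι J)) :
    ‖ampl ι b.defect y‖ ^ 2 = ‖y‖ ^ 2 - ‖ampl ι (adjoint b.opR) y‖ ^ 2 := by
  have h := (l2_hasSum y).sub (l2_hasSum (ampl ι (adjoint b.opR) y))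
  refine (l2_hasSum (ampl ι b.defect y)).unique ?_
  have e : (fun j => ‖ampl ι b.defect y j‖ ^ 2) =
      fun j => ‖y j‖ ^ 2 - ‖ampl ι (adjoint b.opR) y j‖ ^ 2 :=
    funext fun j => b.norm_defect_sq (y j)
  rw [e]
  exact h

theorem norm_vacuum_add_leftShift_le (f : Fock ι H) :
    ‖adjoint (vacuum ι H) f‖ ^ 2 +
      ‖adjoint (leftShift ι H).toContinuousLinearMap f‖ ^ 2 ≤ ‖f‖ ^ 2 := by
  classical
  set a := adjoint (vacuum ι H) f with ha
  set z := adjoint (leftShift ι H).toContinuousLinearMap f with hz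
  have hvac : ∀ x : H, ‖vacuum ι H x‖ = ‖x‖ := fun x => by
    simp [vacuum, lp.norm_single]
  have horth : inner ℂ (vacuum ι H a) (leftShift ι H z) = 0 := by
    have : vacuum ι H a = lp.single 2 [] a := by
      simp only [vacuum, lp.singleContinuousLinearMap_apply]
      congr!
    rw [this, lp.inner_single_left, leftShift_nil, inner_zero_right]
  have h1 : ‖vacuum ι H a + leftShift ι H z‖ ^ 2 = ‖a‖ ^ 2 + ‖z‖ ^ 2 := by
    have := norm_add_sq_eq_norm_sq_add_norm_sq_of_inner_eq_zero _ _ horth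
    rw [hvac, LinearIsometry.norm_map] at this
    simpa only [sq] using this
  have h2 : (inner ℂ (vacuum ι H a + leftShift ι H z) f : ℂ).re = ‖a‖ ^ 2 + ‖z‖ ^ 2 := by
    have e1 : inner ℂ (vacuum ι H a) f = inner ℂ a a := (adjoint_inner_right _ _ _).symm
    have e2 : inner ℂ (leftShift ι H z) f = inner ℂ z z :=
      (adjoint_inner_right (leftShift ι H).toContinuousLinearMap z f).symm
    rw [inner_add_left, e1, e2, Complex.add_re]
    exact congrArg₂ _ (inner_self_eq_norm_sq (𝕜 := ℂ) a) (inner_self_eq_norm_sq (𝕜 := ℂ) z)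
  have h3 : (inner ℂ (vacuum ι H a + leftShift ι H z) f : ℂ).re ≤
      ‖vacuum ι H a + leftShift ι H z‖ * ‖f‖ := re_inner_le_norm (𝕜 := ℂ) _ _
  rw [h2] at h3
  nlinarith [norm_nonneg f, norm_nonneg (vacuum ι H a + leftShift ι H z),
    sq_nonneg (‖vacuum ι H a + leftShift ι H z‖ - ‖f‖)]

/-- An operator into `(ℍ²_d ⊗ J) ⊗ ℂ^d` that factors through `√(I - b(R) b(R)*) ⊗ I` takes its
values in `𝓗ᵗ(b) ⊗ ℂ^d`. -/
theorem exists_lift (b : ContractiveMultiplier ι H J) {K : Type*} [NormedAddCommGroup K]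
    [InnerProductSpace ℂ K] [CompleteSpace K] (A : K →L[ℂ] l2 ι (Fock ι J))
    (h : ∀ y, ‖adjoint A y‖ ^ 2 ≤ ‖y‖ ^ 2 - ‖ampl ι (adjoint b.opR) y‖ ^ 2) :
    ∃ C : K →L[ℂ] l2 ι b.DBR, ∀ x j, OperatorRange.incl b.defect (C x j) = A x j := by
  obtain ⟨C, hC⟩ := exists_factor A (ampl ι b.defect) fun y => by
    rw [adjoint_ampl, adjoint_defect]
    refine (sq_le_sq₀ (norm_nonneg _) (norm_nonneg _)).1 ?_
    rw [norm_ampl_defect_sq]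
    exact h y
  refine ⟨ampl ι (OperatorRange.corestrict b.defect) ∘L C, fun x j => ?_⟩
  rw [← hC]
  exact OperatorRange.incl_corestrict b.defect (C x j)

theorem exists_backwardShift (b : ContractiveMultiplier ι H J) :
    ∃ X : b.DBR →L[ℂ] l2 ι b.DBR, ∀ f j, OperatorRange.incl b.defect (X f j) =
      adjoint (leftShift ι J).toContinuousLinearMap (OperatorRange.incl b.defect f) j := by
  obtain ⟨C, hC⟩ := b.exists_lift
    (adjoint (leftShift ι J).toContinuousLinearMap ∘L b.defect) fun y => by
      rw [adjoint_comp, adjoint_adjoint, adjoint_defect]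
      change ‖b.defect (leftShift ι J y)‖ ^ 2 ≤ _
      rw [norm_defect_sq, LinearIsometry.norm_map]
      have h := norm_vacuum_add_leftShift_le (adjoint b.opR (leftShift ι J y))
      rw [adjoint_leftShift_adjoint_opR] at h
      nlinarith [sq_nonneg ‖adjoint (vacuum ι H) (adjoint b.opR (leftShift ι J y))‖]
  refine ⟨C ∘L OperatorRange.preimageCLM b.defect, fun f j => ?_⟩
  have h1 := hC (OperatorRange.preimage b.defect f) j
  have h2 := OperatorRange.apply_preimage b.defect f
  rw [← h2]
  exact h1

/-- `X = (L* ⊗ I_J)|_{𝓗ᵗ(b)} : 𝓗ᵗ(b) → 𝓗ᵗ(b) ⊗ ℂ^d`. -/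
def X (b : ContractiveMultiplier ι H J) : b.DBR →L[ℂ] l2 ι b.DBR := b.exists_backwardShift.choose

theorem incl_X (b : ContractiveMultiplier ι H J) (f : b.DBR) (j : ι) :
    OperatorRange.incl b.defect (b.X f j) =
      adjoint (leftShift ι J).toContinuousLinearMap (OperatorRange.incl b.defect f) j :=
  b.exists_backwardShift.choose_spec f j

theorem exists_bold (b : ContractiveMultiplier ι H J) :
    ∃ β : H →L[ℂ] l2 ι b.DBR, ∀ h j, OperatorRange.incl b.defect (β h j) =
      adjoint (leftShift ι J).toContinuousLinearMap (b.opR (vacuum ι H h)) j := by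
  refine b.exists_lift
    (adjoint (leftShift ι J).toContinuousLinearMap ∘L b.opR ∘L vacuum ι H) fun y => ?_
  rw [adjoint_comp, adjoint_comp, adjoint_adjoint]
  have h1 := norm_vacuum_add_leftShift_le (adjoint b.opR (leftShift ι J y))
  rw [adjoint_leftShift_adjoint_opR] at h1
  have h2 := b.norm_adjoint_opR_apply_le (leftShift ι J y)
  rw [LinearIsometry.norm_map] at h2
  have h3 := pow_le_pow_left₀ (norm_nonneg _) h2 2
  change ‖adjoint (vacuum ι H) (adjoint b.opR (leftShift ι J y))‖ ^ 2 ≤ _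
  linarith

/-- The operator `𝐛 : H → 𝓗ᵗ(b) ⊗ ℂ^d`, `𝐛 h = (L* ⊗ I_J) b(R) (1 ⊗ h)`. -/
def bold (b : ContractiveMultiplier ι H J) : H →L[ℂ] l2 ι b.DBR := b.exists_bold.choose

theorem incl_bold (b : ContractiveMultiplier ι H J) (h : H) (j : ι) :
    OperatorRange.incl b.defect (b.bold h j) =
      adjoint (leftShift ι J).toContinuousLinearMap (b.opR (vacuum ι H h)) j :=
  b.exists_bold.choose_spec h j

end ContractiveMultiplier
end DeBrangesRovnyak

/-! ### Purity -/

section Purity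

variable {ι : Type u} {K : Type v} [NormedAddCommGroup K] [InnerProductSpace ℂ K]

/-- `Ad_{T,T*}(A) = T₁ A T₁* + ⋯ + T_d A T_d* = T (A ⊗ I_d) T*` for a row
`T = (T₁, …, T_d) : K ⊗ ℂ^d → K`. -/
def adMap [CompleteSpace K] (T : l2 ι K →L[ℂ] K) (A : K →L[ℂ] K) : K →L[ℂ] K :=
  T ∘L ampl ι A ∘L adjoint T

/-- The row `T` is pure if `Ad_{T,T*}^{(n)}(I) → 0` in the strong operator topology. -/
def IsPure [CompleteSpace K] (T : l2 ι K →L[ℂ] K) : Prop :=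
  ∀ x : K, Filter.Tendsto (fun n : ℕ => ((adMap T)^[n] 1) x) Filter.atTop (nhds 0)

/-- The index set `S × ι × ⋯ × ι` (`n` factors `ι`), so that
`K ⊗ ℓ²(S) ⊗ (ℂ^d)^{⊗ n} = l2 (TensorIndex S ι n) K`. -/
def TensorIndex (S ι : Type u) : ℕ → Type u
  | 0 => S
  | n + 1 => TensorIndex S ι n × ι

/-- For a column `X : K → K ⊗ ℂ^d`, the operator
`X^{(n)} ⊗ I : K ⊗ ℓ²(S) → K ⊗ ℓ²(S) ⊗ (ℂ^d)^{⊗ n}`, where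
`X^{(n)} = (X ⊗ I ⊗ ⋯ ⊗ I) ⋯ (X ⊗ I) X`. -/
def iterColumn (S : Type u) (X : K →L[ℂ] l2 ι K) :
    (n : ℕ) → l2 S K →L[ℂ] l2 (TensorIndex S ι n) K
  | 0 => ContinuousLinearMap.id ℂ (l2 S K)
  | n + 1 => uncurry.toContinuousLinearMap ∘L ampl (TensorIndex S ι n) X ∘L iterColumn S X n

end Purity

end FreeHardy

end

noncomputable section

namespace FreeHardy

open ContinuousLinearMap
open scoped ENNReal

universe u v

/-! ### Sums over words -/

section Sums

variable {S : Type*} {K : Type*} [NormedAddCommGroup K]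

/-! The multiplier `b` is the transfer function of its canonical colligation `U = (X, 𝐛; f ↦ f_∅,
b_∅)`, which is a contraction (`norm_colligation_le`, `coeff_eq_transferCoeff`). Let `D = √(I -
U*U)`. For a unit vector `u ∈ J` and `‖w‖ ≤ 1`, the extra output `⟨w, D ·⟩ u` can be adjoined to `U`
without losing contractivity. Its transfer function `a` therefore makes the column of `b` and `a`
contractive. Column-extremality forces `a ≡ 0` for every such `w`, so `D` vanishes on `0 ⊕ H` and on
all states reachable from `H` (`colligationDefect_eq_zero`): `U` loses no energy there.

Telescoping this energy balance over words gives `‖X^(n) 𝐛 h‖² + ∑_{|ω| ≤ n} ‖b_ω h‖² = ‖h‖²`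
(`norm_iterColumn_bold`). Weak purity thus makes `b(L)` isometric on constants. Since `b(R)`
commutes with the left shifts, it is then isometric on monomials, and because it is a contraction,
`b(R)* b(R) = I` everywhere (`isInner_of_norm_opL_vacuum`).

Conversely, if `b` is inner, then `𝓗ᵗ(b)` sits isometrically in the Fock space and `X` is a
restriction of `L*`, so `X*` inherits purity from `L` (`IsInner.isPure`). Purity implies weak purity
through `X^(n)* X^(n) = Ad^(n)(I)` (`inner_iterColumn`). Only the passage from weak purity to inner
uses column-extremality. -/

theorem l2_tsum_ofReal (f : l2 S K) :
    ∑' s, ENNReal.ofReal (‖f s‖ ^ 2) = ENNReal.ofReal (‖f‖ ^ 2) := by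
  rw [l2_norm_sq, ENNReal.ofReal_tsum_of_nonneg (fun _ => by positivity) (l2_hasSum f).summable]

/-- Energy estimates are carried out in `ℝ≥0∞`, where sums rearrange freely; finiteness of the total
then supplies the summability needed to return to `ℓ²`. -/
theorem exists_l2_of_tsum_le (g : S → K) {c : ℝ} (hc : 0 ≤ c)
    (h : ∑' s, ENNReal.ofReal (‖g s‖ ^ 2) ≤ ENNReal.ofReal (c ^ 2)) :
    ∃ G : l2 S K, (∀ s, G s = g s) ∧ ‖G‖ ≤ c := by
  have hs : Summable fun s => ‖g s‖ ^ 2 := by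
    have h1 := ENNReal.summable_toReal (ne_top_of_le_ne_top ENNReal.ofReal_ne_top h)
    refine h1.congr fun s => ?_
    rw [ENNReal.toReal_ofReal (by positivity)]
  refine ⟨⟨g, (memlp_two_iff g).2 hs⟩, fun _ => rfl, ?_⟩
  rw [← sq_le_sq₀ (norm_nonneg _) hc, ← ENNReal.ofReal_le_ofReal_iff (by positivity),
    ← l2_tsum_ofReal]
  exact h

variable {ι : Type u}

/-- The word spelled by a multi-index, the last index being the first letter. -/
def indexWord : (n : ℕ) → TensorIndex ι ι n → Word ι
  | 0, s => [s]
  | n + 1, t => t.2 :: indexWord n t.1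

theorem indexWord_ne_nil : ∀ (n : ℕ) (t : TensorIndex ι ι n), indexWord n t ≠ []
  | 0, _ => List.cons_ne_nil _ _
  | _ + 1, _ => List.cons_ne_nil _ _

theorem indexWord_injective :
    Function.Injective fun p : (Σ n, TensorIndex ι ι n) => indexWord p.1 p.2 := by
  rintro ⟨n, t⟩ ⟨m, s⟩ h
  change indexWord n t = indexWord m s at h
  induction n generalizing m with
  | zero =>
    cases m with
    | zero =>
      have h' : t = s := (List.cons.inj h).1
      rw [h']
    | succ m => exact absurd (List.cons.inj h).2.symm (indexWord_ne_nil _ _)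
  | succ n ih =>
    cases m with
    | zero => exact absurd (List.cons.inj h).2 (indexWord_ne_nil _ _)
    | succ m =>
      obtain ⟨t, j⟩ := t
      obtain ⟨s, i⟩ := s
      have h1 : j = i := (List.cons.inj h).1
      have h2 := ih t m s (List.cons.inj h).2
      cases h1
      cases h2
      rfl

theorem exists_indexWord_eq (ω : Word ι) (hω : ω ≠ []) : ∃ n t, indexWord n t = ω := by
  induction ω with
  | nil => exact absurd rfl hω
  | cons j ω ih =>
    by_cases h : ω = []
    · subst h
      exact ⟨0, j, rfl⟩
    · obtain ⟨n, t, rfl⟩ := ih h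
      exact ⟨n + 1, (t, j), rfl⟩

/-- Grading of words by length. The empty word stands apart because `indexWord n` spells exactly the
words of length `n + 1`. -/
theorem tsum_word (g : Word ι → ℝ≥0∞) :
    ∑' ω, g ω = g [] + ∑' n, ∑' t : TensorIndex ι ι n, g (indexWord n t) := by
  classical
  rw [ENNReal.tsum_eq_add_tsum_ite [], ← ENNReal.tsum_sigma
    (fun n (t : TensorIndex ι ι n) => g (indexWord n t))]
  congr 1
  rw [← indexWord_injective.tsum_eq]
  · refine tsum_congr fun p => ?_
    rw [if_neg (indexWord_ne_nil _ _)]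
  · intro ω hω
    have h : ω ≠ [] := fun h => hω (by simp [h])
    obtain ⟨n, t, rfl⟩ := exists_indexWord_eq ω h
    exact ⟨⟨n, t⟩, rfl⟩

theorem tsum_tensorIndex_succ (n : ℕ) (g : TensorIndex ι ι (n + 1) → ℝ≥0∞) :
    ∑' t, g t = ∑' t : TensorIndex ι ι n, ∑' j : ι, g (t, j) :=
  ENNReal.tsum_prod' (α := TensorIndex ι ι n) (β := ι) (f := g)

/-- A discrete energy estimate on the tree of words. -/
theorem tsum_word_le_of_step {p q y : Word ι → ℝ≥0∞} (h0 : p [] = 0)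
    (h : ∀ ω, ∑' j, p (j :: ω) + y ω ≤ p ω + q ω) : ∑' ω, y ω ≤ ∑' ω, q ω := by
  -- Here `p` is stored energy, `q` supplied and `y` emitted: what is stored at length `n + 1` plus
  -- all emission up to length `n` is bounded by the supply up to length `n`.
  have key : ∀ n : ℕ, ∑' t : TensorIndex ι ι n, p (indexWord n t) +
      (y [] + ∑ k ∈ Finset.range n, ∑' t : TensorIndex ι ι k, y (indexWord k t)) ≤
      q [] + ∑ k ∈ Finset.range n, ∑' t : TensorIndex ι ι k, q (indexWord k t) := by
    intro n
    induction n with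
    | zero =>
      have h1 := h []
      rw [h0, zero_add] at h1
      rw [Finset.sum_range_zero, Finset.sum_range_zero, add_zero, add_zero]
      exact h1
    | succ n ih =>
      rw [tsum_tensorIndex_succ, Finset.sum_range_succ, Finset.sum_range_succ]
      have hn : ∑' t : TensorIndex ι ι n, ∑' j : ι, p (j :: indexWord n t) +
          ∑' t : TensorIndex ι ι n, y (indexWord n t) ≤
          ∑' t : TensorIndex ι ι n, p (indexWord n t) +
          ∑' t : TensorIndex ι ι n, q (indexWord n t) := by
        rw [← ENNReal.tsum_add, ← ENNReal.tsum_add]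
        exact ENNReal.tsum_le_tsum fun t => h _
      change ∑' t : TensorIndex ι ι n, ∑' j : ι, p (j :: indexWord n t) + _ ≤ _
      calc _ = (∑' t : TensorIndex ι ι n, ∑' j : ι, p (j :: indexWord n t) +
            ∑' t : TensorIndex ι ι n, y (indexWord n t)) +
            (y [] + ∑ k ∈ Finset.range n, ∑' t : TensorIndex ι ι k, y (indexWord k t)) := by ring
        _ ≤ _ := add_le_add_left hn _
        _ = (∑' t : TensorIndex ι ι n, p (indexWord n t) +
            (y [] + ∑ k ∈ Finset.range n, ∑' t : TensorIndex ι ι k, y (indexWord k t))) +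
            ∑' t : TensorIndex ι ι n, q (indexWord n t) := by ring
        _ ≤ _ := add_le_add_left ih _
        _ = _ := by ring
  rw [tsum_word y, tsum_word q]
  -- The stored energy is discarded before passing to the limit.
  refine le_of_tendsto_of_tendsto'
    ((ENNReal.tendsto_nat_tsum _).const_add _) ((ENNReal.tendsto_nat_tsum _).const_add _)
    fun n => le_trans ?_ (key n)
  exact le_add_self

end Sums

/-! ### Transfer functions of contractive colligations -/

section Transfer

variable {ι : Type u} {K H E : Type*}
  [NormedAddCommGroup K] [InnerProductSpace ℂ K]
  [NormedAddCommGroup H] [InnerProductSpace ℂ H]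
  [NormedAddCommGroup E] [InnerProductSpace ℂ E]

/-- The coordinate `K ⊗ ℂ^d → K`. -/
def coord (K : Type*) [NormedAddCommGroup K] [InnerProductSpace ℂ K] (j : ι) : l2 ι K →L[ℂ] K :=
  lp.evalCLM ℂ (fun _ : ι => K) 2 j

/-- The input-to-state operators `X_{i_n} ⋯ X_{i_2} β_{i_1}`, indexed by the words
`i_n ⋯ i_1`. -/
def state (X : K →L[ℂ] l2 ι K) (β : H →L[ℂ] l2 ι K) : Word ι → H →L[ℂ] K
  | [] => 0
  | [j] => coord K j ∘L β
  | j :: k :: ω => coord K j ∘L X ∘L state X β (k :: ω)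

theorem state_cons (X : K →L[ℂ] l2 ι K) (β : H →L[ℂ] l2 ι K) (j : ι) {ω : Word ι} (hω : ω ≠ []) :
    state X β (j :: ω) = coord K j ∘L X ∘L state X β ω := by
  cases ω with
  | nil => exact absurd rfl hω
  | cons k ω => rfl

theorem iterColumn_apply_eq_state (X : K →L[ℂ] l2 ι K) (β : H →L[ℂ] l2 ι K) (h : H) :
    ∀ (n : ℕ) (t : TensorIndex ι ι n),
      iterColumn ι X n (β h) t = state X β (indexWord n t) h
  | 0, _ => rfl
  | n + 1, (t, j) => by
    change X (iterColumn ι X n (β h) t) j = state X β (j :: indexWord n t) h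
    rw [iterColumn_apply_eq_state X β h n t, state_cons X β j (indexWord_ne_nil n t)]
    rfl

/-- The Taylor coefficients of the transfer function of the colligation
`(X, β; C, G) : K ⊕ H → (K ⊗ ℂ^d) ⊕ E`. -/
def transferCoeff (X : K →L[ℂ] l2 ι K) (β : H →L[ℂ] l2 ι K) (C : K →L[ℂ] E) (G : H →L[ℂ] E) :
    Word ι → H →L[ℂ] E
  | [] => G
  | j :: ω => C ∘L state X β (j :: ω)

theorem seriesMul_cons (b : Word ι → H →L[ℂ] E) (f : Word ι → H) (j : ι) (ω : Word ι) :
    seriesMul b f (j :: ω) = b [] (f (j :: ω)) + seriesMul (fun α => b (j :: α)) f ω := by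
  rw [seriesMul, List.length_cons, Finset.sum_range_succ', add_comm]
  rfl

/-- The state equation of the linear system on the tree of words driven by the input `f`. The
convention `state X β [] = 0` encodes the zero initial state, and the companion output equation is
`seriesMul_transferCoeff`. -/
theorem seriesMul_state_cons (X : K →L[ℂ] l2 ι K) (β : H →L[ℂ] l2 ι K) (f : Word ι → H) (j : ι)
    (ω : Word ι) : seriesMul (state X β) f (j :: ω) =
      (X (seriesMul (state X β) f ω) + β (f ω)) j := by
  rw [seriesMul_cons]
  change (0 : H →L[ℂ] K) _ + _ = coord K j (X (seriesMul (state X β) f ω) + β (f ω))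
  rw [zero_apply, zero_add, seriesMul, seriesMul, Finset.sum_range_succ', Finset.sum_range_succ',
    map_add, map_add]
  have e0 : X (state X β (ω.take 0) (f (ω.drop 0))) = 0 := by simp [state]
  rw [e0, add_zero]
  congr 1
  rw [map_sum, map_sum]
  refine Finset.sum_congr rfl fun k hk => ?_
  rw [state_cons]
  · rfl
  · intro h
    have hk := Finset.mem_range.1 hk
    have hω : ω = [] := by simpa using h
    simp [hω] at hk

theorem seriesMul_transferCoeff (X : K →L[ℂ] l2 ι K) (β : H →L[ℂ] l2 ι K) (C : K →L[ℂ] E)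
    (G : H →L[ℂ] E) (f : Word ι → H) (ω : Word ι) :
    seriesMul (transferCoeff X β C G) f ω = C (seriesMul (state X β) f ω) + G (f ω) := by
  rw [seriesMul, seriesMul, Finset.sum_range_succ', Finset.sum_range_succ', map_add, map_sum]
  have e0 : C (state X β (ω.take 0) (f (ω.drop 0))) = 0 := by simp [state]
  rw [e0, add_zero]
  congr 1
  refine Finset.sum_congr rfl fun k hk => ?_
  have hk := Finset.mem_range.1 hk
  cases ω with
  | nil => simp at hk
  | cons j ω => rfl

/-- The transfer function of a contractive colligation is a contractive multiplier. -/
theorem isContractiveMultiplier_transferCoeff (X : K →L[ℂ] l2 ι K) (β : H →L[ℂ] l2 ι K)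
    (C : K →L[ℂ] E) (G : H →L[ℂ] E)
    (hU : ∀ x h, ‖X x + β h‖ ^ 2 + ‖C x + G h‖ ^ 2 ≤ ‖x‖ ^ 2 + ‖h‖ ^ 2) :
    IsContractiveMultiplier (transferCoeff X β C G) := by
  intro f
  refine exists_l2_of_tsum_le _ (norm_nonneg f) ?_
  rw [← l2_tsum_ofReal]
  refine tsum_word_le_of_step
    (p := fun ω => ENNReal.ofReal (‖seriesMul (state X β) f ω‖ ^ 2)) ?_ fun ω => ?_
  · simp [seriesMul, state]
  · simp only [seriesMul_state_cons, seriesMul_transferCoeff]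
    rw [l2_tsum_ofReal, ← ENNReal.ofReal_add (by positivity) (by positivity),
      ← ENNReal.ofReal_add (by positivity) (by positivity)]
    exact ENNReal.ofReal_le_ofReal (hU _ _)

end Transfer

/-! ### Operators on orthogonal sums and factorization -/

section Rows

variable {K K₁ K₂ : Type*}
  [NormedAddCommGroup K] [InnerProductSpace ℂ K] [CompleteSpace K]
  [NormedAddCommGroup K₁] [InnerProductSpace ℂ K₁] [CompleteSpace K₁]
  [NormedAddCommGroup K₂] [InnerProductSpace ℂ K₂] [CompleteSpace K₂]

/-- The row operator `(A₁, A₂) : K₁ ⊕ K₂ → K`. -/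
def rowOp (A₁ : K₁ →L[ℂ] K) (A₂ : K₂ →L[ℂ] K) : WithLp 2 (K₁ × K₂) →L[ℂ] K :=
  (A₁.coprod A₂) ∘L (WithLp.prodContinuousLinearEquiv 2 ℂ K₁ K₂).toContinuousLinearMap

theorem rowOp_apply (A₁ : K₁ →L[ℂ] K) (A₂ : K₂ →L[ℂ] K) (x : WithLp 2 (K₁ × K₂)) :
    rowOp A₁ A₂ x = A₁ x.fst + A₂ x.snd := rfl

theorem adjoint_rowOp_apply (A₁ : K₁ →L[ℂ] K) (A₂ : K₂ →L[ℂ] K) (y : K) :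
    adjoint (rowOp A₁ A₂) y = WithLp.toLp 2 (adjoint A₁ y, adjoint A₂ y) := by
  apply ext_inner_left ℂ
  intro x
  rw [adjoint_inner_right, rowOp_apply, inner_add_left, WithLp.prod_inner_apply]
  simp only [← adjoint_inner_right]
  rfl

theorem norm_adjoint_rowOp_sq (A₁ : K₁ →L[ℂ] K) (A₂ : K₂ →L[ℂ] K) (y : K) :
    ‖adjoint (rowOp A₁ A₂) y‖ ^ 2 = ‖adjoint A₁ y‖ ^ 2 + ‖adjoint A₂ y‖ ^ 2 := by
  rw [adjoint_rowOp_apply, WithLp.prod_norm_sq_eq_of_L2]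
  rfl

/-- The Douglas factorization lemma, with the norm bound. -/
theorem exists_preimage_norm_le (A : K₁ →L[ℂ] K) (D : K₂ →L[ℂ] K)
    (h : ∀ y, ‖adjoint A y‖ ≤ ‖adjoint D y‖) (x : K₁) : ∃ z, D z = A x ∧ ‖z‖ ≤ ‖x‖ := by
  let M : Submodule ℂ K₂ := (LinearMap.range (adjoint D : K →ₗ[ℂ] K₂)).topologicalClosure
  have : CompleteSpace M := (Submodule.isClosed_topologicalClosure _).completeSpace_coe
  let e : K →ₗ[ℂ] M := LinearMap.codRestrict M (adjoint D : K →ₗ[ℂ] K₂)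
    fun y => Submodule.le_topologicalClosure _ ⟨y, rfl⟩
  have he : DenseRange e := by
    intro x
    rw [Topology.IsEmbedding.subtypeVal.closure_eq_preimage_closure_image, Set.mem_preimage]
    have : (Subtype.val '' Set.range e : Set K₂) = LinearMap.range (adjoint D : K →ₗ[ℂ] K₂) := by
      rw [← Set.range_comp]
      rfl
    rw [this]
    exact x.2
  have hn : ∀ y, ‖(adjoint A : K →ₗ[ℂ] K₁) y‖ ≤ 1 * ‖e y‖ := fun y => by simpa [e] using h y
  let g : M →L[ℂ] K₁ := (adjoint A : K →ₗ[ℂ] K₁).extendOfNorm e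
  have hg : ∀ y, g (e y) = adjoint A y := fun y => LinearMap.extendOfNorm_eq he ⟨1, hn⟩ y
  have hg1 : ‖g‖ ≤ 1 := LinearMap.opNorm_extendOfNorm_le he zero_le_one hn
  -- The contraction `g` extends `D* y ↦ A* y`, so `g D* = A*`, and taking adjoints gives `D g* =
  -- A`.
  refine ⟨(adjoint g x : M), ?_, ?_⟩
  · apply ext_inner_right ℂ
    intro y
    rw [← adjoint_inner_right, ← adjoint_inner_right A, ← hg, ← adjoint_inner_left g]
    rfl
  · have h1 : ‖adjoint g‖ ≤ 1 := by rwa [LinearIsometryEquiv.norm_map]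
    simpa using (adjoint g).le_of_opNorm_le h1 x

namespace OperatorRange

/-- The range norm is the least norm of a preimage, since projecting onto `(ker A)ᗮ` preserves the
image under `A` and does not increase the norm. -/
theorem norm_le_of_apply_eq (A : K₁ →L[ℂ] K) (f : OperatorRange A) (x : K₁)
    (h : A x = incl A f) : ‖f‖ ≤ ‖x‖ := by
  have : CompleteSpace (LinearMap.ker (A : K₁ →ₗ[ℂ] K)) :=
    (ContinuousLinearMap.isClosed_ker A).completeSpace_coe
  have hf : corestrict A x = f := incl_injective A ((incl_corestrict A x).trans h)
  rw [← hf]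
  change ‖unitary A ((LinearMap.ker (A : K₁ →ₗ[ℂ] K))ᗮ.orthogonalProjectionOnto x)‖ ≤ ‖x‖
  rw [LinearIsometryEquiv.norm_map]
  exact Submodule.norm_orthogonalProjectionOnto_apply_le _ x

end OperatorRange

end Rows

/-! ### The decomposition of the Fock space into constants and the range of the left shift -/

section Shift

variable {ι : Type u} {E : Type*} [NormedAddCommGroup E] [InnerProductSpace ℂ E]

theorem vacuum_nil (h : E) : vacuum ι E h [] = h := by
  simp [vacuum, lp.singleContinuousLinearMap_apply]

theorem vacuum_of_ne_nil (h : E) {ω : Word ι} (hω : ω ≠ []) : vacuum ι E h ω = 0 := by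
  simp [vacuum, lp.singleContinuousLinearMap_apply, hω]

theorem norm_vacuum (h : E) : ‖vacuum ι E h‖ = ‖h‖ := by
  simp [vacuum, lp.norm_single]

variable [CompleteSpace E]

theorem adjoint_vacuum_apply (f : Fock ι E) : adjoint (vacuum ι E) f = f [] := by
  classical
  apply ext_inner_left ℂ
  intro x
  have : vacuum ι E x = lp.single 2 [] x := by
    simp only [vacuum, lp.singleContinuousLinearMap_apply]
    congr!
  rw [adjoint_inner_right, this, lp.inner_single_left]

theorem leftShift_single [DecidableEq ι] (j : ι) (ω : Word ι) (x : E) :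
    leftShift ι E (lp.single 2 j (lp.single 2 ω x)) = lp.single 2 (j :: ω) x := by
  ext α
  cases α with
  | nil => rw [leftShift_nil]; simp [lp.single_apply]
  | cons i α =>
    rw [leftShift_cons]
    by_cases hi : i = j
    · subst hi
      by_cases hα : α = ω
      · subst hα; simp
      · simp [hα]
    · simp [hi]

theorem adjoint_leftShift_apply (f : Fock ι E) (j : ι) (ω : Word ι) :
    adjoint (leftShift ι E).toContinuousLinearMap f j ω = f (j :: ω) := by
  classical
  apply ext_inner_left ℂ
  intro x
  rw [← lp.inner_single_left (G := fun _ : Word ι => E) ω x,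
    ← lp.inner_single_left (G := fun _ : ι => Fock ι E) j, adjoint_inner_right]
  change inner ℂ (leftShift ι E _) f = _
  rw [leftShift_single, lp.inner_single_left]

theorem vacuum_add_leftShift (f : Fock ι E) :
    vacuum ι E (f []) + leftShift ι E (adjoint (leftShift ι E).toContinuousLinearMap f) = f := by
  ext ω
  rw [lp.coeFn_add, Pi.add_apply]
  cases ω with
  | nil => rw [vacuum_nil, leftShift_nil, add_zero]
  | cons j ω =>
    rw [vacuum_of_ne_nil _ (List.cons_ne_nil _ _), leftShift_cons, adjoint_leftShift_apply,
      zero_add]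

theorem norm_sq_eq_vacuum_add_leftShift (f : Fock ι E) :
    ‖f‖ ^ 2 = ‖f []‖ ^ 2 + ‖adjoint (leftShift ι E).toContinuousLinearMap f‖ ^ 2 := by
  have horth : inner ℂ (vacuum ι E (f []))
      (leftShift ι E (adjoint (leftShift ι E).toContinuousLinearMap f)) = 0 := by
    rw [← adjoint_inner_right, adjoint_vacuum_apply, leftShift_nil, inner_zero_right]
  have h := norm_add_sq_eq_norm_sq_add_norm_sq_of_inner_eq_zero _ _ horth
  rw [vacuum_add_leftShift, norm_vacuum, LinearIsometry.norm_map] at h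
  simpa only [sq] using h

end Shift

/-! ### The canonical colligation of a contractive multiplier -/

namespace ContractiveMultiplier

variable {ι : Type u} {H J : Type*}
  [NormedAddCommGroup H] [InnerProductSpace ℂ H] [CompleteSpace H]
  [NormedAddCommGroup J] [InnerProductSpace ℂ J] [CompleteSpace J]

theorem seriesMul_vacuum (b : Word ι → H →L[ℂ] J) (h : H) (ω : Word ι) :
    seriesMul b (vacuum ι H h) ω = b ω h := by
  rw [seriesMul, Finset.sum_range_succ, Finset.sum_eq_zero, zero_add]
  · simp [vacuum_nil]
  · intro k hk
    rw [vacuum_of_ne_nil, map_zero]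
    simpa using Finset.mem_range.1 hk

theorem opL_vacuum_apply (b : ContractiveMultiplier ι H J) (h : H) (ω : Word ι) :
    b.opL (vacuum ι H h) ω = b.coeff ω h := by
  rw [opL_apply, seriesMul_vacuum]

theorem reversal_vacuum (h : H) : reversal ι H (vacuum ι H h) = vacuum ι H h := by
  ext ω
  rw [reversal_apply]
  by_cases hω : ω = []
  · subst hω; rfl
  · rw [vacuum_of_ne_nil _ hω, vacuum_of_ne_nil _ (by simpa using hω)]

theorem opR_vacuum_apply (b : ContractiveMultiplier ι H J) (h : H) (ω : Word ι) :
    b.opR (vacuum ι H h) ω = b.coeff ω.reverse h := by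
  change reversal ι J (b.opL (reversal ι H (vacuum ι H h))) ω = _
  rw [reversal_vacuum, reversal_apply, opL_vacuum_apply]

theorem adjoint_leftShift_adjoint_opR_apply (b : ContractiveMultiplier ι H J) (f : Fock ι J) :
    adjoint (leftShift ι H).toContinuousLinearMap (adjoint b.opR f) =
      ampl ι (adjoint b.opR) (adjoint (leftShift ι J).toContinuousLinearMap f) := by
  apply ext_inner_left ℂ
  intro x
  rw [adjoint_inner_right, adjoint_inner_right, ← adjoint_ampl, adjoint_inner_right,
    adjoint_inner_right]
  congr 1
  exact b.opR_leftShift x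

/-- The value at the vacuum, `𝓗ᵗ(b) → J`, `f ↦ f_∅`. -/
def constCoeff (b : ContractiveMultiplier ι H J) : b.DBR →L[ℂ] J :=
  adjoint (vacuum ι J) ∘L b.defect ∘L OperatorRange.preimageCLM b.defect

theorem constCoeff_apply (b : ContractiveMultiplier ι H J) (f : b.DBR) :
    b.constCoeff f = OperatorRange.incl b.defect f [] := by
  rw [← OperatorRange.apply_preimage, ← adjoint_vacuum_apply]
  rfl

/-- The canonical colligation of `b` is contractive. -/
theorem norm_colligation_le (b : ContractiveMultiplier ι H J) (f : b.DBR) (h : H) :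
    ‖b.X f + b.bold h‖ ^ 2 + ‖b.constCoeff f + b.coeff [] h‖ ^ 2 ≤ ‖f‖ ^ 2 + ‖h‖ ^ 2 := by
  set L := (leftShift ι J).toContinuousLinearMap with hL
  -- Factor the row `(√(I - b(R)b(R)*), b(R)|_H)` through `(L(√(I - b(R)b(R)*) ⊗ I), 1 ⊗ ·)`. The
  -- Douglas inequality is in fact an equality: split `φ` and `b(R)*φ` into constant and shifted
  -- parts and use that `b(R)*` intertwines the backward shifts.
  obtain ⟨z, hz, hzn⟩ := exists_preimage_norm_le
    (rowOp b.defect (b.opR ∘L vacuum ι H)) (rowOp (L ∘L ampl ι b.defect) (vacuum ι J)) (fun φ => by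
      rw [← sq_le_sq₀ (norm_nonneg _) (norm_nonneg _), norm_adjoint_rowOp_sq,
        norm_adjoint_rowOp_sq, adjoint_comp, adjoint_comp, adjoint_ampl, adjoint_defect]
      change ‖b.defect φ‖ ^ 2 + ‖adjoint (vacuum ι H) (adjoint b.opR φ)‖ ^ 2 ≤
        ‖ampl ι b.defect (adjoint L φ)‖ ^ 2 + _
      rw [norm_ampl_defect_sq, norm_defect_sq, norm_sq_eq_vacuum_add_leftShift φ,
        norm_sq_eq_vacuum_add_leftShift (adjoint b.opR φ), adjoint_leftShift_adjoint_opR_apply,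
        adjoint_vacuum_apply, adjoint_vacuum_apply]
      linarith)
    (WithLp.toLp 2 (OperatorRange.preimage b.defect f, h))
  rw [rowOp_apply, rowOp_apply] at hz
  change leftShift ι J (ampl ι b.defect z.fst) + vacuum ι J z.snd =
    b.defect (OperatorRange.preimage b.defect f) + b.opR (vacuum ι H h) at hz
  rw [OperatorRange.apply_preimage] at hz
  have h1 : z.snd = b.constCoeff f + b.coeff [] h := by
    have := congrArg (fun F : Fock ι J => F []) hz
    simp only [lp.coeFn_add, Pi.add_apply, leftShift_nil, vacuum_nil, opR_vacuum_apply] at this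
    simpa [constCoeff_apply] using this
  -- The nonconstant coefficients of `hz` show that `z.fst j` is a preimage of `(X f + 𝐛 h)_j`, so
  -- it bounds the range norm of that component.
  have h2 : ∀ j, b.defect (z.fst j) = OperatorRange.incl b.defect ((b.X f + b.bold h) j) := by
    intro j
    ext ω
    have := congrArg (fun F : Fock ι J => F (j :: ω)) hz
    simp only [lp.coeFn_add, Pi.add_apply, leftShift_cons,
      vacuum_of_ne_nil _ (List.cons_ne_nil j ω), add_zero, ampl_apply] at this
    rw [this, lp.coeFn_add, Pi.add_apply, map_add, incl_X, incl_bold, lp.coeFn_add, Pi.add_apply,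
      adjoint_leftShift_apply, adjoint_leftShift_apply]
  have h3 : ‖b.X f + b.bold h‖ ^ 2 ≤ ‖z.fst‖ ^ 2 := by
    refine hasSum_le (fun j => ?_) (l2_hasSum _) (l2_hasSum z.fst)
    exact pow_le_pow_left₀ (norm_nonneg _) (OperatorRange.norm_le_of_apply_eq _ _ _ (h2 j)) 2
  have h4 := pow_le_pow_left₀ (norm_nonneg _) hzn 2
  rw [WithLp.prod_norm_sq_eq_of_L2, WithLp.prod_norm_sq_eq_of_L2] at h4
  rw [← h1, OperatorRange.norm_def b.defect f]
  have h5 : ‖(WithLp.toLp 2 (OperatorRange.preimage b.defect f, h)).fst‖ ^ 2 =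
    ‖OperatorRange.preimage b.defect f‖ ^ 2 := rfl
  have h6 : ‖(WithLp.toLp 2 (OperatorRange.preimage b.defect f, h)).snd‖ ^ 2 = ‖h‖ ^ 2 := rfl
  linarith

/-- Reachable states are iterated backward left shifts of `b(R)(1 ⊗ h)`, whose coefficient at `α` is
`b_{αᵗ} h`. Each shift inserts one letter after `αᵗ`; at `α = ∅` this recovers the Taylor
coefficients of `b`. -/
theorem incl_state_apply (b : ContractiveMultiplier ι H J) (h : H) (ω : Word ι) (hω : ω ≠ [])
    (α : Word ι) : OperatorRange.incl b.defect (state b.X b.bold ω h) α =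
      b.coeff (α.reverse ++ ω) h := by
  induction ω generalizing α with
  | nil => exact absurd rfl hω
  | cons j ω ih =>
    by_cases h0 : ω = []
    · subst h0
      change OperatorRange.incl b.defect (b.bold h j) α = _
      rw [incl_bold, adjoint_leftShift_apply, opR_vacuum_apply, List.reverse_cons]
    · rw [state_cons _ _ j h0]
      change OperatorRange.incl b.defect (b.X (state b.X b.bold ω h) j) α = _
      rw [incl_X, adjoint_leftShift_apply, ih h0, List.reverse_cons, List.append_assoc]
      rfl

theorem constCoeff_state (b : ContractiveMultiplier ι H J) (h : H) (ω : Word ι) (hω : ω ≠ []) :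
    b.constCoeff (state b.X b.bold ω h) = b.coeff ω h := by
  rw [constCoeff_apply, incl_state_apply b h ω hω]
  rfl

/-- `b` is the transfer function of its canonical colligation. -/
theorem coeff_eq_transferCoeff (b : ContractiveMultiplier ι H J) (ω : Word ι) :
    b.coeff ω = transferCoeff b.X b.bold b.constCoeff (b.coeff []) ω := by
  cases ω with
  | nil => rfl
  | cons j ω =>
    ext h
    exact (b.constCoeff_state h _ (List.cons_ne_nil _ _)).symm

end ContractiveMultiplier

namespace ContractiveMultiplier

variable {ι : Type u} {H J : Type*}
  [NormedAddCommGroup H] [InnerProductSpace ℂ H] [CompleteSpace H]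
  [NormedAddCommGroup J] [InnerProductSpace ℂ J] [CompleteSpace J]

/-! ### Column-extreme multipliers -/

/-- The canonical colligation `(X, 𝐛; f ↦ f_∅, b_∅) : 𝓗ᵗ(b) ⊕ H → (𝓗ᵗ(b) ⊗ ℂ^d) ⊕ J`. -/
def colligation (b : ContractiveMultiplier ι H J) :
    WithLp 2 (b.DBR × H) →L[ℂ] WithLp 2 (l2 ι b.DBR × J) :=
  (WithLp.prodContinuousLinearEquiv 2 ℂ (l2 ι b.DBR) J).symm.toContinuousLinearMap ∘L
    (rowOp b.X b.bold).prod (rowOp b.constCoeff (b.coeff []))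

theorem norm_colligation_sq (b : ContractiveMultiplier ι H J) (f : b.DBR) (h : H) :
    ‖b.colligation (WithLp.toLp 2 (f, h))‖ ^ 2 =
      ‖b.X f + b.bold h‖ ^ 2 + ‖b.constCoeff f + b.coeff [] h‖ ^ 2 :=
  WithLp.prod_norm_sq_eq_of_L2 _

theorem norm_toLp_sq {K₁ K₂ : Type*} [NormedAddCommGroup K₁] [NormedAddCommGroup K₂]
    (x : K₁) (y : K₂) : ‖WithLp.toLp 2 (x, y)‖ ^ 2 = ‖x‖ ^ 2 + ‖y‖ ^ 2 :=
  WithLp.prod_norm_sq_eq_of_L2 _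

/-- The defect operator `√(I - U*U)` of the canonical colligation `U`. -/
def colligationDefect (b : ContractiveMultiplier ι H J) :
    WithLp 2 (b.DBR × H) →L[ℂ] WithLp 2 (b.DBR × H) :=
  sqrtDefect (adjoint b.colligation)

/-- The defect accounts exactly for the energy the colligation loses, so an additional output
dominated by it keeps the colligation contractive. -/
theorem norm_colligationDefect_sq (b : ContractiveMultiplier ι H J) (f : b.DBR) (h : H) :
    ‖b.X f + b.bold h‖ ^ 2 + ‖b.constCoeff f + b.coeff [] h‖ ^ 2 +
      ‖b.colligationDefect (WithLp.toLp 2 (f, h))‖ ^ 2 = ‖f‖ ^ 2 + ‖h‖ ^ 2 := by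
  rw [colligationDefect, norm_sqrtDefect_sq, adjoint_adjoint, norm_colligation_sq, norm_toLp_sq]
  · ring
  · rw [adjoint_adjoint]
    rintro ⟨f, h⟩
    rw [← sq_le_sq₀ (norm_nonneg _) (norm_nonneg _), norm_colligation_sq, norm_toLp_sq]
    exact b.norm_colligation_le f h

/-- If `b` is column-extreme, every complement `a` of `b` to the transfer function of a contractive
colligation vanishes. -/
theorem IsColumnExtreme.transferCoeff_eq_zero {b : ContractiveMultiplier ι H J}
    (hb : b.IsColumnExtreme) (C : b.DBR →L[ℂ] J) (G : H →L[ℂ] J)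
    (hCG : ∀ f h, ‖C f + G h‖ ≤ ‖b.colligationDefect (WithLp.toLp 2 (f, h))‖) (ω : Word ι) :
    transferCoeff b.X b.bold C G ω = 0 := by
  have hsq : ∀ f h, ‖b.X f + b.bold h‖ ^ 2 +
      (‖b.constCoeff f + b.coeff [] h‖ ^ 2 + ‖C f + G h‖ ^ 2) ≤ ‖f‖ ^ 2 + ‖h‖ ^ 2 := by
    intro f h
    have h1 := pow_le_pow_left₀ (norm_nonneg _) (hCG f h) 2
    have h2 := b.norm_colligationDefect_sq f h
    linarith
  let a : ContractiveMultiplier ι H J := ⟨transferCoeff b.X b.bold C G,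
    isContractiveMultiplier_transferCoeff _ _ _ _ fun f h => by
      have := hsq f h
      have := sq_nonneg ‖b.constCoeff f + b.coeff [] h‖
      linarith⟩
  refine hb a ?_ ω
  let e := (WithLp.prodContinuousLinearEquiv 2 ℂ J J).symm.toContinuousLinearMap
  -- Both entries share the same state dynamics, so the column is the transfer function with the two
  -- outputs stacked.
  have hcol : column b a = transferCoeff b.X b.bold (e ∘L b.constCoeff.prod C)
      (e ∘L (b.coeff []).prod G) := by
    funext ω
    rw [column, b.coeff_eq_transferCoeff ω]
    cases ω <;> rfl
  rw [hcol]
  refine isContractiveMultiplier_transferCoeff _ _ _ _ fun f h => ?_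
  refine le_trans (le_of_eq ?_) (hsq f h)
  congr 1
  exact WithLp.prod_norm_sq_eq_of_L2 _

/-- The defect takes values in a space unrelated to `J`, so it is tested through rank-one maps `v ↦
⟨w, v⟩ u` into `J`. Each gives an admissible complement, which must vanish. -/
theorem IsColumnExtreme.colligationDefect_eq_zero [Nontrivial J] {b : ContractiveMultiplier ι H J}
    (hb : b.IsColumnExtreme) (h : H) :
    b.colligationDefect (WithLp.toLp 2 (0, h)) = 0 ∧
      ∀ ω ≠ [], b.colligationDefect (WithLp.toLp 2 (state b.X b.bold ω h, 0)) = 0 := by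
  obtain ⟨u, hu⟩ := exists_norm_eq J zero_le_one
  let e := (WithLp.prodContinuousLinearEquiv 2 ℂ b.DBR H).symm.toContinuousLinearMap
  let T : WithLp 2 (b.DBR × H) → WithLp 2 (b.DBR × H) →L[ℂ] J := fun w =>
    (innerSL ℂ w).smulRight u ∘L b.colligationDefect
  let C : WithLp 2 (b.DBR × H) → b.DBR →L[ℂ] J := fun w => T w ∘L e ∘L .inl ℂ b.DBR H
  let G : WithLp 2 (b.DBR × H) → H →L[ℂ] J := fun w => T w ∘L e ∘L .inr ℂ b.DBR H
  have hC : ∀ w f, C w f = inner ℂ w (b.colligationDefect (WithLp.toLp 2 (f, 0))) • u :=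
    fun _ _ => rfl
  have hG : ∀ w h, G w h = inner ℂ w (b.colligationDefect (WithLp.toLp 2 (0, h))) • u :=
    fun _ _ => rfl
  have hzero : ∀ w, ‖w‖ ≤ 1 → ∀ ω, transferCoeff b.X b.bold (C w) (G w) ω = 0 := by
    intro w hw
    refine hb.transferCoeff_eq_zero _ _ fun f h => ?_
    have hsum : (WithLp.toLp 2 (f, (0 : H)) + WithLp.toLp 2 ((0 : b.DBR), h)) =
        WithLp.toLp 2 (f, h) := by
      rw [← WithLp.toLp_add]
      simp
    rw [hC, hG, ← add_smul, ← inner_add_right, ← map_add, hsum, norm_smul, hu, mul_one]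
    refine (norm_inner_le_norm _ _).trans ?_
    exact mul_le_of_le_one_left (norm_nonneg _) hw
  have hu0 : u ≠ 0 := fun h => by simp [h] at hu
  have hvan : ∀ v : WithLp 2 (b.DBR × H),
      (∀ w, ‖w‖ ≤ 1 → inner ℂ w v • u = 0) → v = 0 := by
    intro v hv
    by_contra hne
    -- Testing against `w = v / ‖v‖` already suffices.
    have h1 := hv (((‖v‖⁻¹ : ℝ) : ℂ) • v) (by
      rw [norm_smul]
      simp [norm_ne_zero_iff.2 hne])
    rw [smul_eq_zero_iff_left hu0, inner_smul_left, mul_eq_zero, inner_self_eq_zero] at h1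
    simp [hne] at h1
  -- The empty-word coefficient of the complement sees `D` on `0 ⊕ H`; the coefficient at `ω ≠ ∅`
  -- sees `D` on the state reached along `ω`.
  refine ⟨hvan _ fun w hw => ?_, fun ω hω => hvan _ fun w hw => ?_⟩
  · rw [← hG]
    exact congrArg (fun A : H →L[ℂ] J => A h) (hzero w hw [])
  · rw [← hC]
    cases ω with
    | nil => exact absurd rfl hω
    | cons j ω => exact congrArg (fun A : H →L[ℂ] J => A h) (hzero w hw (j :: ω))

theorem IsColumnExtreme.norm_bold_sq [Nontrivial J] {b : ContractiveMultiplier ι H J}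
    (hb : b.IsColumnExtreme) (h : H) : ‖b.bold h‖ ^ 2 + ‖b.coeff [] h‖ ^ 2 = ‖h‖ ^ 2 := by
  have h1 := b.norm_colligationDefect_sq 0 h
  rw [(hb.colligationDefect_eq_zero h).1] at h1
  simpa using h1

theorem IsColumnExtreme.norm_X_state_sq [Nontrivial J] {b : ContractiveMultiplier ι H J}
    (hb : b.IsColumnExtreme) (h : H) (ω : Word ι) (hω : ω ≠ []) :
    ‖b.X (state b.X b.bold ω h)‖ ^ 2 + ‖b.coeff ω h‖ ^ 2 = ‖state b.X b.bold ω h‖ ^ 2 := by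
  have h1 := b.norm_colligationDefect_sq (state b.X b.bold ω h) 0
  rw [(hb.colligationDefect_eq_zero h).2 ω hω] at h1
  simpa [b.constCoeff_state h ω hω] using h1

/-- Telescoping of the lossless balance: the components of `X^(n) 𝐛 h` are the states along words of
length `n + 1`, and one more step emits the coefficients of `b` at exactly those words. -/
theorem IsColumnExtreme.norm_iterColumn_bold [Nontrivial J] {b : ContractiveMultiplier ι H J}
    (hb : b.IsColumnExtreme) (h : H) (n : ℕ) :
    ENNReal.ofReal (‖iterColumn ι b.X n (b.bold h)‖ ^ 2) +
      (ENNReal.ofReal (‖b.coeff [] h‖ ^ 2) + ∑ k ∈ Finset.range n,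
        ∑' t : TensorIndex ι ι k, ENNReal.ofReal (‖b.coeff (indexWord k t) h‖ ^ 2)) =
      ENNReal.ofReal (‖h‖ ^ 2) := by
  induction n with
  | zero =>
    rw [Finset.sum_range_zero, add_zero, ← ENNReal.ofReal_add (by positivity) (by positivity),
      ← hb.norm_bold_sq h]
    rfl
  | succ n ih =>
    have hstep : ENNReal.ofReal (‖iterColumn ι b.X (n + 1) (b.bold h)‖ ^ 2) +
        ∑' t : TensorIndex ι ι n, ENNReal.ofReal (‖b.coeff (indexWord n t) h‖ ^ 2) =
        ENNReal.ofReal (‖iterColumn ι b.X n (b.bold h)‖ ^ 2) := by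
      have h1 : ‖iterColumn ι b.X (n + 1) (b.bold h)‖ =
          ‖ampl (TensorIndex ι ι n) b.X (iterColumn ι b.X n (b.bold h))‖ :=
        LinearIsometry.norm_map uncurry _
      rw [h1, ← l2_tsum_ofReal, ← l2_tsum_ofReal, ← ENNReal.tsum_add]
      refine tsum_congr fun t => ?_
      rw [ampl_apply, iterColumn_apply_eq_state, ← ENNReal.ofReal_add (by positivity)
        (by positivity), hb.norm_X_state_sq h _ (indexWord_ne_nil n t)]
    rw [← ih, Finset.sum_range_succ, ← hstep]
    ring

theorem IsColumnExtreme.norm_opL_vacuum [Nontrivial J] {b : ContractiveMultiplier ι H J}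
    (hb : b.IsColumnExtreme) (h : H) (hw : Filter.Tendsto
      (fun n : ℕ => ‖iterColumn ι b.X n (b.bold h)‖) Filter.atTop (nhds 0)) :
    ‖b.opL (vacuum ι H h)‖ = ‖h‖ := by
  have h1 : Filter.Tendsto (fun n : ℕ => ENNReal.ofReal (‖iterColumn ι b.X n (b.bold h)‖ ^ 2))
      Filter.atTop (nhds 0) := by
    have := ENNReal.tendsto_ofReal (hw.pow 2)
    simpa using this
  have h2 := h1.add ((ENNReal.tendsto_nat_tsum fun k =>
    ∑' t : TensorIndex ι ι k, ENNReal.ofReal (‖b.coeff (indexWord k t) h‖ ^ 2)).const_add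
      (ENNReal.ofReal (‖b.coeff [] h‖ ^ 2)))
  simp only [hb.norm_iterColumn_bold h, zero_add] at h2
  have h3 := tendsto_nhds_unique h2 tendsto_const_nhds
  rw [← tsum_word fun ω => ENNReal.ofReal (‖b.coeff ω h‖ ^ 2)] at h3
  simp only [← b.opL_vacuum_apply] at h3
  rw [l2_tsum_ofReal, ENNReal.ofReal_eq_ofReal_iff (by positivity) (by positivity),
    sq_eq_sq₀ (norm_nonneg _) (norm_nonneg _)] at h3
  exact h3

/-! ### Inner multipliers -/

theorem reversal_reversal (f : Fock ι H) : reversal ι H (reversal ι H f) = f := by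
  ext ω
  rw [reversal_apply, reversal_apply, List.reverse_reverse]

theorem norm_opR_reversal (b : ContractiveMultiplier ι H J) (f : Fock ι H) :
    ‖b.opR (reversal ι H f)‖ = ‖b.opL f‖ := by
  change ‖reversal ι J (b.opL (reversal ι H (reversal ι H f)))‖ = _
  rw [LinearIsometry.norm_map, reversal_reversal]

/-- Equality case for a contraction: if no norm is lost, then `‖b(R)*b(R)f - f‖² ≤ ‖f‖² - 2‖f‖² +
‖f‖² = 0`. -/
theorem adjoint_opR_opR_eq_self_iff (b : ContractiveMultiplier ι H J) (f : Fock ι H) :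
    adjoint b.opR (b.opR f) = f ↔ ‖b.opR f‖ = ‖f‖ := by
  have hin : RCLike.re (inner ℂ (adjoint b.opR (b.opR f)) f) = ‖b.opR f‖ ^ 2 := by
    rw [adjoint_inner_left, inner_self_eq_norm_sq]
  constructor
  · intro h
    rw [h, inner_self_eq_norm_sq] at hin
    exact ((sq_eq_sq₀ (norm_nonneg _) (norm_nonneg _)).1 hin).symm
  · intro h
    have h1 := norm_sub_sq (𝕜 := ℂ) (adjoint b.opR (b.opR f)) f
    rw [hin, h] at h1
    have h3 := pow_le_pow_left₀ (norm_nonneg _) (b.norm_adjoint_opR_apply_le (b.opR f)) 2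
    rw [h] at h3
    have h4 : ‖adjoint b.opR (b.opR f) - f‖ ^ 2 ≤ 0 := by linarith
    have h5 : ‖adjoint b.opR (b.opR f) - f‖ = 0 := by
      nlinarith [norm_nonneg (adjoint b.opR (b.opR f) - f)]
    exact sub_eq_zero.1 (norm_eq_zero.1 h5)

/-- Commutation with the left shifts carries isometry of `b(R)` from constants to monomials, letter
by letter. -/
theorem isInner_of_norm_opL_vacuum (b : ContractiveMultiplier ι H J)
    (hv : ∀ h, ‖b.opL (vacuum ι H h)‖ = ‖h‖) : b.IsInner := by
  classical
  have hsingle : ∀ (ω : Word ι) (h : H), ‖b.opR (lp.single 2 ω h)‖ = ‖h‖ := by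
    intro ω h
    induction ω with
    | nil =>
      have e : (lp.single 2 [] h : Fock ι H) = vacuum ι H h := by
        simp only [vacuum, lp.singleContinuousLinearMap_apply]
        congr!
      rw [e, ← reversal_vacuum, norm_opR_reversal, hv]
    | cons j ω ih =>
      rw [← leftShift_single, opR_leftShift, LinearIsometry.norm_map]
      have e : ampl ι b.opR (lp.single 2 j (lp.single 2 ω h)) =
          lp.single 2 j (b.opR (lp.single 2 ω h)) := by
        ext1
        funext i
        rw [ampl_apply]
        by_cases hi : i = j
        · subst hi; simp
        · simp [hi]
      rw [e, lp.norm_single (by norm_num), ih]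
  -- Preservation of norms on monomials does not pass to sums, but the equivalent identity
  -- `b(R)*b(R)f = f` is linear and closed.
  have hid : ∀ f : Fock ι H, adjoint b.opR (b.opR f) = f := by
    intro f
    have h1 := lp.hasSum_single (p := 2) (by norm_num) f
    have h2 := h1.mapL (adjoint b.opR ∘L b.opR)
    refine h2.unique (h1.congr_fun ?_)
    intro ω
    refine (b.adjoint_opR_opR_eq_self_iff _).2 ?_
    rw [hsingle, lp.norm_single (by norm_num)]
  refine AddMonoidHomClass.isometry_of_norm b.opL fun f => ?_
  rw [← norm_opR_reversal, (b.adjoint_opR_opR_eq_self_iff _).1 (hid _), LinearIsometry.norm_map]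

theorem IsInner.norm_opR {b : ContractiveMultiplier ι H J} (hb : b.IsInner) (f : Fock ι H) :
    ‖b.opR f‖ = ‖f‖ := by
  rw [← reversal_reversal f, norm_opR_reversal, LinearIsometry.norm_map]
  exact (AddMonoidHomClass.isometry_iff_norm b.opL).1 hb _

/-- For inner `b` the defect kills `ran b(R)`. Hence `(ker)ᗮ` of the defect lies in `ker b(R)*`,
where the defect is isometric. -/
theorem IsInner.norm_incl {b : ContractiveMultiplier ι H J} (hb : b.IsInner) (f : b.DBR) :
    ‖OperatorRange.incl b.defect f‖ = ‖f‖ := by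
  have hker : ∀ k, b.opR k ∈ LinearMap.ker (b.defect : Fock ι J →ₗ[ℂ] Fock ι J) := by
    intro k
    have h1 := b.norm_defect_sq (b.opR k)
    rw [(b.adjoint_opR_opR_eq_self_iff k).2 (hb.norm_opR k), hb.norm_opR, sub_self] at h1
    exact norm_eq_zero.1 (pow_eq_zero_iff two_ne_zero |>.1 h1)
  obtain ⟨g, rfl⟩ := (OperatorRange.unitary b.defect).surjective f
  rw [LinearIsometryEquiv.norm_map]
  change ‖b.defect g‖ = ‖(g : Fock ι J)‖
  have h0 : adjoint b.opR (g : Fock ι J) = 0 := by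
    apply ext_inner_left ℂ
    intro k
    rw [adjoint_inner_right, inner_zero_right]
    exact (Submodule.mem_orthogonal _ _).1 g.2 _ (hker k)
  rw [← sq_eq_sq₀ (norm_nonneg _) (norm_nonneg _), norm_defect_sq, h0]
  simp

end ContractiveMultiplier

/-! ### Purity -/

section Purity

variable {ι : Type u} {K : Type v} [NormedAddCommGroup K] [InnerProductSpace ℂ K] [CompleteSpace K]

/-- Each application strips a first letter and restores it, so the iterates are the projections onto
words of length at least `n`, which decrease to zero. -/
theorem adMap_leftShift_iterate_apply (n : ℕ) (f : Fock ι K) (ω : Word ι) :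
    ((adMap (leftShift ι K).toContinuousLinearMap)^[n] 1) f ω =
      if n ≤ ω.length then f ω else 0 := by
  induction n generalizing f ω with
  | zero => simp
  | succ n ih =>
    rw [Function.iterate_succ_apply']
    change leftShift ι K (ampl ι _ (adjoint (leftShift ι K).toContinuousLinearMap f)) ω = _
    cases ω with
    | nil => simp [leftShift_nil]
    | cons j ω =>
      rw [leftShift_cons, ampl_apply, ih, adjoint_leftShift_apply]
      simp

theorem l2_tendsto_zero_of_dominated {S : Type*} {F : ℕ → l2 S K} {f : l2 S K}
    (hF : ∀ s, Filter.Tendsto (fun n => F n s) Filter.atTop (nhds 0))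
    (hle : ∀ n s, ‖F n s‖ ≤ ‖f s‖) : Filter.Tendsto F Filter.atTop (nhds 0) := by
  have h : Filter.Tendsto (fun n => ∑' s, ‖F n s‖ ^ 2) Filter.atTop (nhds (∑' _ : S, (0 : ℝ))) := by
    refine tendsto_tsum_of_dominated_convergence (l2_hasSum f).summable (fun s => ?_)
      (Filter.Eventually.of_forall fun n s => ?_)
    · simpa using ((hF s).norm).pow 2
    · rw [Real.norm_of_nonneg (by positivity)]
      exact pow_le_pow_left₀ (norm_nonneg _) (hle n s) 2
  simp only [← l2_norm_sq, tsum_zero] at h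
  rw [tendsto_zero_iff_norm_tendsto_zero]
  have h' := h.sqrt
  simpa using h'

theorem isPure_leftShift : IsPure (leftShift ι K).toContinuousLinearMap := by
  intro f
  refine l2_tendsto_zero_of_dominated (f := f) (fun ω => ?_) fun n ω => ?_
  · refine tendsto_const_nhds.congr' ?_
    filter_upwards [Filter.eventually_gt_atTop ω.length] with n hn
    rw [adMap_leftShift_iterate_apply, if_neg (by omega)]
  · rw [adMap_leftShift_iterate_apply]
    split_ifs <;> simp

/-- Purity passes to the compression to a co-invariant subspace. -/
theorem IsPure.of_isometry {K' : Type*} [NormedAddCommGroup K'] [InnerProductSpace ℂ K']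
    [CompleteSpace K'] {T : l2 ι K →L[ℂ] K} (hT : IsPure T) {X : K' →L[ℂ] l2 ι K'}
    (V : K' →L[ℂ] K) (hV : ∀ x, ‖V x‖ = ‖x‖) (hX : ∀ x, ampl ι V (X x) = adjoint T (V x)) :
    IsPure (adjoint X) := by
  -- The base case is `V*V = I`; the inductive step uses `(V ⊗ I) X = T* V` on both sides of the
  -- conjugation.
  have hit : ∀ n : ℕ, ((adMap (adjoint X))^[n] 1) = adjoint V ∘L ((adMap T)^[n] 1) ∘L V := by
    intro n
    induction n with
    | zero =>
      have := (norm_map_iff_adjoint_comp_self V).1 hV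
      exact this.symm
    | succ n ih =>
      rw [Function.iterate_succ_apply', Function.iterate_succ_apply', ih]
      ext x
      apply ext_inner_left ℂ
      intro y
      simp only [adMap, adjoint_adjoint, comp_apply, adjoint_inner_right]
      rw [← adjoint_inner_left T, ← hX x, ← hX y, ← adjoint_inner_right (ampl ι V), adjoint_ampl]
      rfl
  intro x
  simp only [hit]
  have h := ((adjoint V).continuous.tendsto 0).comp (hT (V x))
  rw [map_zero] at h
  exact h

/-- Only `A = I` is needed later; general `A` lets the induction absorb the outermost factor of
`X^(n + 1)`, replacing `A` by `X*(A ⊗ I)X`. -/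
theorem inner_iterColumn {S : Type u} (X : K →L[ℂ] l2 ι K) (n : ℕ) (A : K →L[ℂ] K) (f g : l2 S K) :
    inner ℂ (iterColumn S X n f) (ampl (TensorIndex S ι n) A (iterColumn S X n g)) =
      inner ℂ f (ampl S ((adMap (adjoint X))^[n] A) g) := by
  induction n generalizing A with
  | zero => rfl
  | succ n ih =>
    rw [Function.iterate_succ_apply, ← ih]
    have h1 : ampl (TensorIndex S ι (n + 1)) A (iterColumn S X (n + 1) g) =
        uncurry (ampl (TensorIndex S ι n) (ampl ι A)
          (ampl (TensorIndex S ι n) X (iterColumn S X n g))) := rfl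
    have h2 : iterColumn S X (n + 1) f =
        uncurry (ampl (TensorIndex S ι n) X (iterColumn S X n f)) := rfl
    rw [h1, h2]
    refine (LinearIsometry.inner_map_map
      (uncurry : l2 (TensorIndex S ι n) (l2 ι K) →ₗᵢ[ℂ] _) _ _).trans ?_
    rw [← adjoint_inner_right, adjoint_ampl, adMap, adjoint_adjoint]
    rfl

theorem norm_ampl_apply_le {S : Type*} {K' : Type*} [NormedAddCommGroup K'] [InnerProductSpace ℂ K']
    {A : K →L[ℂ] K'} (hA : ∀ x, ‖A x‖ ≤ ‖x‖) (f : l2 S K) : ‖ampl S A f‖ ≤ ‖f‖ := by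
  rw [← sq_le_sq₀ (norm_nonneg _) (norm_nonneg _)]
  refine hasSum_le (fun s => ?_) (l2_hasSum (ampl S A f)) (l2_hasSum f)
  exact pow_le_pow_left₀ (norm_nonneg _) (hA (f s)) 2

theorem norm_adMap_iterate_apply_le {X : K →L[ℂ] l2 ι K} (hX : ∀ x, ‖X x‖ ≤ ‖x‖) (n : ℕ) (x : K) :
    ‖((adMap (adjoint X))^[n] 1) x‖ ≤ ‖x‖ := by
  have hXa : ∀ y, ‖adjoint X y‖ ≤ ‖y‖ := by
    have h1 : ‖X‖ ≤ 1 := X.opNorm_le_bound zero_le_one fun x => by simpa using hX x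
    have h2 : ‖adjoint X‖ ≤ 1 := by rwa [LinearIsometryEquiv.norm_map]
    intro y
    simpa using (adjoint X).le_of_opNorm_le h2 y
  induction n generalizing x with
  | zero => simp
  | succ n ih =>
    rw [Function.iterate_succ_apply']
    change ‖adjoint X (ampl ι _ (adjoint (adjoint X) x))‖ ≤ _
    rw [adjoint_adjoint]
    exact (hXa _).trans ((norm_ampl_apply_le ih _).trans (hX x))

/-- Contractivity of `X` bounds the iterates of `Ad` uniformly, so dominated convergence carries
their strong limit from `K` to the possibly infinite sum `K ⊗ ℓ²(S)`. -/
theorem IsPure.tendsto_norm_iterColumn {S : Type u} {X : K →L[ℂ] l2 ι K} (hX : ∀ x, ‖X x‖ ≤ ‖x‖)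
    (hp : IsPure (adjoint X)) (f : l2 S K) :
    Filter.Tendsto (fun n : ℕ => ‖iterColumn S X n f‖) Filter.atTop (nhds 0) := by
  have h1 : Filter.Tendsto (fun n : ℕ => ampl S ((adMap (adjoint X))^[n] 1) f) Filter.atTop
      (nhds 0) :=
    l2_tendsto_zero_of_dominated (fun s => hp (f s))
      fun n s => norm_adMap_iterate_apply_le hX n (f s)
  have h2 : ∀ n : ℕ, ‖iterColumn S X n f‖ ^ 2 =
      RCLike.re (inner ℂ f (ampl S ((adMap (adjoint X))^[n] 1) f)) := by
    intro n
    rw [← inner_iterColumn, ← inner_self_eq_norm_sq (𝕜 := ℂ)]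
    rfl
  have h3 : Filter.Tendsto (fun n : ℕ => ‖iterColumn S X n f‖ ^ 2) Filter.atTop (nhds 0) := by
    simp only [h2]
    have h4 := (RCLike.continuous_re.tendsto _).comp
      ((tendsto_const_nhds (x := f)).inner (𝕜 := ℂ) h1)
    rw [inner_zero_right, map_zero] at h4
    exact h4
  simpa using h3.sqrt

end Purity

/-! ### Purity for inner multipliers -/

namespace ContractiveMultiplier

variable {ι : Type u} {H J : Type*}
  [NormedAddCommGroup H] [InnerProductSpace ℂ H] [CompleteSpace H]
  [NormedAddCommGroup J] [InnerProductSpace ℂ J] [CompleteSpace J]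

theorem norm_X_apply_le (b : ContractiveMultiplier ι H J) (f : b.DBR) : ‖b.X f‖ ≤ ‖f‖ := by
  have h := b.norm_colligation_le f 0
  rw [map_zero, map_zero, add_zero, add_zero, norm_zero] at h
  rw [← sq_le_sq₀ (norm_nonneg _) (norm_nonneg _)]
  nlinarith [sq_nonneg ‖b.constCoeff f‖]

theorem IsInner.isPure {b : ContractiveMultiplier ι H J} (hb : b.IsInner) :
    IsPure (adjoint b.X) := by
  have hV : ∀ f, (b.defect ∘L OperatorRange.preimageCLM b.defect) f =
      OperatorRange.incl b.defect f := OperatorRange.apply_preimage b.defect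
  refine isPure_leftShift.of_isometry (b.defect ∘L OperatorRange.preimageCLM b.defect)
    (fun f => by rw [hV, hb.norm_incl]) fun f => ?_
  ext1
  funext j
  rw [ampl_apply, hV, hV, incl_X]

end ContractiveMultiplier

end FreeHardy

end

theorem mainTheorem6 {ι : Type*} [Countable ι] {H J : Type*}
    [NormedAddCommGroup H] [InnerProductSpace ℂ H] [CompleteSpace H]
    [TopologicalSpace.SeparableSpace H]
    [NormedAddCommGroup J] [InnerProductSpace ℂ J] [CompleteSpace J]
    [TopologicalSpace.SeparableSpace J] [Nontrivial J]
    (b : FreeHardy.ContractiveMultiplier ι H J) (hb : b.IsColumnExtreme) :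
    (b.IsInner ↔ ∀ h : H, Filter.Tendsto
      (fun n : ℕ => ‖FreeHardy.iterColumn ι b.X n (b.bold h)‖) Filter.atTop (nhds 0)) ∧
    (FreeHardy.IsPure (ContinuousLinearMap.adjoint b.X) ↔ b.IsInner) := by
  have hweak : FreeHardy.IsPure (ContinuousLinearMap.adjoint b.X) → ∀ h : H, Filter.Tendsto
      (fun n : ℕ => ‖FreeHardy.iterColumn ι b.X n (b.bold h)‖) Filter.atTop (nhds 0) :=
    fun hp h => hp.tendsto_norm_iterColumn b.norm_X_apply_le (b.bold h)
  have hinner : (∀ h : H, Filter.Tendsto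
      (fun n : ℕ => ‖FreeHardy.iterColumn ι b.X n (b.bold h)‖) Filter.atTop (nhds 0)) →
      b.IsInner :=
    fun hw => b.isInner_of_norm_opL_vacuum fun h => hb.norm_opL_vacuum h (hw h)
  exact ⟨⟨fun h => hweak h.isPure, hinner⟩, fun hp => hinner (hweak hp), fun h => h.isPure⟩
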